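/- Let $X_1,X_2,\ldots$ be i.i.d. uniform on $[0,1]$, let $\xi_1,\xi_2,\ldots$ be i.i.d. real errors with $\mathbb{E}\,\xi_1=0$ that are independent of $(X_i)_{i\ge 1}$, and let $Y_i=f_0(X_i)+\xi_i$, where $f_0:[0,1]\to\mathbb{R}$ is measurable. No shape constraint is imposed on $f_0$. Write $\|f\|_\infty=\sup_{x\in[0,1]}|f(x)|$. Let $\mathcal{F}$ be either the class of non-decreasing functions on $[0,1]$ (isotonic model) or the class of convex functions on $[0,1]$ (convex model). A least squares estimator (LSE) is any minimiser of $f\mapsto\sum_{i=1}^n (Y_i-f(X_i))^2$ over $f\in\mathcal{F}$; it is determined only at the design points $X_1,\ldots,X_n$. The *canonical* LSE $\hat f_n$ is the following one. - Isotonic model: $\hat f_n$ is the LSE that is left-continuous and piecewise constant on $[0,1]$, with jumps only at design points and no jump at the largest design point (so it is constant to the right of it). - Convex model: $\hat f_n$ is the LSE that is continuous and piecewise linear on $[0,1]$, with kinks only at design points and no kink at the smallest or the largest design point (so its first and last linear pieces are extended to $0$ and $1$). Suppose that $\|f_0\|_\infty<\infty$ and $\mathbb{E}\,\xi_1^2<\infty$.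 Then both the canonical isotonic LSE and the canonical convex LSE are stochastically bounded in the supremum norm over $[0,1]$, $\|\hat f_n\|_\infty=O_{\mathbf P}(1)$: for each of the two models and every $\varepsilon>0$ there is $K<\infty$ such that $\mathbb{P}(\|\hat f_n\|_\infty>K)\le\varepsilon$ for all sufficiently large $n$. -/

import Mathlib

open MeasureTheory ProbabilityTheory Filter Set
open scoped ENNReal NNReal

/-- The isotonic model: real functions that are non-decreasing on `[0,1]`
(values outside `[0,1]` play no role). -/
def isotonicModel : Set (ℝ → ℝ) := {f | MonotoneOn f (Icc 0 1)}

/-- The convex model: real functions that are convex on `[0,1]`. -/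
def convexModel : Set (ℝ → ℝ) := {f | ConvexOn ℝ (Icc 0 1) f}

/-- `f` is a least squares estimator over the model `F` for the data `(x i, y i)`, `i < n`. -/
def IsLSE (F : Set (ℝ → ℝ)) {n : ℕ} (x y : Fin n → ℝ) (f : ℝ → ℝ) : Prop :=
  f ∈ F ∧ IsMinOn (fun g : ℝ → ℝ => ∑ i, (y i - g (x i)) ^ 2) F f

/-- The canonical isotonic LSE: the isotonic least squares estimator which, on `[0,1]`, is
left-continuous and piecewise constant with jumps only at design points, and which is constant
to the right of the largest design point (so there is no jump at that point). -/
structure IsCanonicalIsotonicLSE {n : ℕ} (x y : Fin n → ℝ) (f : ℝ → ℝ) : Prop where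
  isLSE : IsLSE isotonicModel x y f
  left_continuous : ∀ t ∈ Icc (0 : ℝ) 1, ContinuousWithinAt f (Icc 0 t) t
  /-- `f` is constant on every `[s,t] ⊆ [0,1]` that contains no design point other than,
  possibly, the largest one. -/
  piecewise_constant : ∀ s t : ℝ, 0 ≤ s → s ≤ t → t ≤ 1 →
    (∀ i, x i ∈ Icc s t → ∀ j, x j ≤ x i) → f s = f t

/-- The canonical convex LSE: the convex least squares estimator which, on `[0,1]`, is
continuous and piecewise linear with kinks only at design points, and which extends its first and
last linear pieces (so there is no kink at the smallest or at the largest design point). -/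
structure IsCanonicalConvexLSE {n : ℕ} (x y : Fin n → ℝ) (f : ℝ → ℝ) : Prop where
  isLSE : IsLSE convexModel x y f
  continuousOn : ContinuousOn f (Icc 0 1)
  /-- `f` is affine on every `[s,t] ⊆ [0,1]` whose interior contains no design point other than,
  possibly, the smallest and the largest one. -/
  piecewise_linear : ∀ s t : ℝ, 0 ≤ s → s ≤ t → t ≤ 1 →
    (∀ i, x i ∈ Ioo s t → (∀ j, x i ≤ x j) ∨ (∀ j, x j ≤ x i)) →
    ∃ a b : ℝ, ∀ u ∈ Icc s t, f u = a * u + b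

/-- The supremum norm over `[0,1]`, with values in `[0,∞]`. -/
noncomputable def supNorm01 (f : ℝ → ℝ) : ℝ≥0∞ := ⨆ t ∈ Icc (0 : ℝ) 1, ‖f t‖ₑ

/-- `Z n = O_P(1)`: for every `ε > 0` there is a finite `K` with `μ (Z n > K) ≤ ε` for all
sufficiently large `n`. -/
def StochasticallyBounded {Ω : Type*} [MeasurableSpace Ω] (μ : Measure Ω)
    (Z : ℕ → Ω → ℝ≥0∞) : Prop :=
  ∀ ε : ℝ≥0∞, 0 < ε → ∃ K : ℝ≥0, ∀ᶠ n in atTop, μ {ω | (K : ℝ≥0∞) < Z n ω} ≤ ε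

/-! ### Least squares over a convex class -/

/-! Both models are convex classes, so the LSE satisfies a variational inequality, tested here
against competitors whose difference from the LSE is monotone in the design. Against such weights
the errors average out uniformly in `n`. By Abel summation it is enough to bound the partial sums of
the errors, taken in the order of the design, by `K * j`. The sorting permutation is independent of
the errors, so the reordered errors keep their law, and the strong law makes the supremum of `|S_j|
/ j` finite almost surely (`exists_measure_not_noiseControlled_le`).

In the isotonic model, truncating the LSE from below at `-(M + K)` gives a competitor that forces
the truncation to be vacuous. Reflection gives the upper bound, and the canonical extension creates
no new extreme values.

In the convex model, comparison with `0` bounds the empirical second moment of the LSE. Every fixed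
interval of length `1/8` holds many design points, so it contains a point where the LSE is bounded.
Convexity turns this into a lower bound on all of `[0,1]`, and the upper bound is needed only at the
two endpoints. At `0`, the competitor smooths out the first kink `τ`. The difference is a multiple
of `w = max 0 (1 - x / τ)`, and the LSE is affine on `[0,τ]`, so `f 0 * ∑ w²` is at most a constant
times `∑ w` (`IsCanonicalConvexLSE.left_end_le`).

It remains to see that `∑ w²` is comparable to `∑ w`, although `τ` depends on the data. This holds
if the design points below each design point do not cluster at it. An exponential moment summed over
all design points shows this: the smallest point always contributes exactly `1`, and the expected
total exceeds `1` only slightly (`measure_two_le_tiltSum_le`). -/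

lemma convex_isotonicModel : Convex ℝ isotonicModel := by
  intro f hf g hg a b ha hb _ s hs t ht hst
  have h1 := mul_le_mul_of_nonneg_left (hf hs ht hst) ha
  have h2 := mul_le_mul_of_nonneg_left (hg hs ht hst) hb
  simpa using add_le_add h1 h2

lemma convex_convexModel : Convex ℝ convexModel := by
  intro f hf g hg a b ha hb _
  exact (ConvexOn.smul ha hf).add (ConvexOn.smul hb hg)

/-- The variational inequality for a projection onto a convex class. -/
lemma IsLSE.sum_mul_sub_nonpos {F : Set (ℝ → ℝ)} (hF : Convex ℝ F) {n : ℕ} {x y : Fin n → ℝ}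
    {f g : ℝ → ℝ} (h : IsLSE F x y f) (hg : g ∈ F) :
    ∑ i, (y i - f (x i)) * (g (x i) - f (x i)) ≤ 0 := by
  set A := ∑ i, (y i - f (x i)) * (g (x i) - f (x i)) with hA
  set B := ∑ i, (g (x i) - f (x i)) ^ 2 with hB
  have key : ∀ e : ℝ, 0 < e → e ≤ 1 → 2 * A ≤ e * B := by
    intro e he he1
    have hmem : (1 - e) • f + e • g ∈ F := hF h.1 hg (by linarith) he.le (by ring)
    have hmin : ∑ i, (y i - f (x i)) ^ 2 ≤ ∑ i, (y i - ((1 - e) • f + e • g) (x i)) ^ 2 :=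
      isMinOn_iff.1 h.2 _ hmem
    have hexp : ∑ i, (y i - ((1 - e) • f + e • g) (x i)) ^ 2
        = ∑ i, (y i - f (x i)) ^ 2 - 2 * e * A + e ^ 2 * B := by
      rw [hA, hB, Finset.mul_sum, Finset.mul_sum, ← Finset.sum_sub_distrib,
        ← Finset.sum_add_distrib]
      refine Finset.sum_congr rfl fun i _ => ?_
      simp only [Pi.add_apply, Pi.smul_apply, smul_eq_mul]
      ring
    have : e * (2 * A) ≤ e * (e * B) := by nlinarith
    exact le_of_mul_le_mul_left this he
  have hB0 : 0 ≤ B := Finset.sum_nonneg fun i _ => sq_nonneg _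
  by_contra hlt
  push Not at hlt
  -- With this step size `e`, `e * B ≤ A`, so `2 * A ≤ e * B` contradicts `A > 0`.
  have hmin : 0 < min 1 (A / (B + 1)) := lt_min one_pos (by positivity)
  have h1 := key _ hmin (min_le_left _ _)
  have h2 : min 1 (A / (B + 1)) * B ≤ A / (B + 1) * (B + 1) := by
    have := min_le_right 1 (A / (B + 1))
    have h0 : 0 ≤ A / (B + 1) := by positivity
    nlinarith
  rw [div_mul_cancel₀ _ (by positivity)] at h2
  linarith

lemma IsLSE.sum_sq_le {F : Set (ℝ → ℝ)} (hF : Convex ℝ F) (h0 : (fun _ => 0) ∈ F) {n : ℕ}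
    {x y : Fin n → ℝ} {f : ℝ → ℝ} (h : IsLSE F x y f) :
    ∑ i, f (x i) ^ 2 ≤ ∑ i, y i ^ 2 := by
  have h1 := h.sum_mul_sub_nonpos hF h0
  have h2 : ∑ i, f (x i) ^ 2 - ∑ i, y i ^ 2
      ≤ 2 * ∑ i, (y i - f (x i)) * (0 - f (x i)) := by
    rw [Finset.mul_sum, ← Finset.sum_sub_distrib]
    refine Finset.sum_le_sum fun i _ => ?_
    nlinarith [sq_nonneg (y i - f (x i))]
  linarith

/-! ### Reflection -/

lemma one_sub_mem_Icc {t : ℝ} (ht : t ∈ Icc (0 : ℝ) 1) : 1 - t ∈ Icc (0 : ℝ) 1 :=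
  ⟨by linarith [ht.2], by linarith [ht.1]⟩

lemma isotonicModel_reflect {f : ℝ → ℝ} (hf : f ∈ isotonicModel) :
    (fun t => -f (1 - t)) ∈ isotonicModel := fun s hs t ht hst =>
  neg_le_neg (hf (one_sub_mem_Icc ht) (one_sub_mem_Icc hs) (by linarith))

lemma convexModel_reflect {f : ℝ → ℝ} (hf : f ∈ convexModel) :
    (fun t => f (1 - t)) ∈ convexModel := by
  refine ⟨convex_Icc 0 1, fun s hs t ht a b ha hb hab => ?_⟩
  have := hf.2 (one_sub_mem_Icc hs) (one_sub_mem_Icc ht) ha hb hab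
  convert this using 2
  simp only [smul_eq_mul]
  linear_combination (-1 : ℝ) * hab

lemma IsLSE.isotonic_reflect {n : ℕ} {x y : Fin n → ℝ} {f : ℝ → ℝ}
    (h : IsLSE isotonicModel x y f) :
    IsLSE isotonicModel (fun i => 1 - x i) (fun i => -y i) (fun t => -f (1 - t)) := by
  refine ⟨isotonicModel_reflect h.1, isMinOn_iff.2 fun g hg => ?_⟩
  have := isMinOn_iff.1 h.2 _ (isotonicModel_reflect hg)
  have e1 : ∀ i, (-y i - -f (1 - (1 - x i))) ^ 2 = (y i - f (x i)) ^ 2 := fun i => by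
    rw [sub_sub_cancel]; ring
  have e2 : ∀ i, (-y i - g (1 - x i)) ^ 2 = (y i - -g (1 - x i)) ^ 2 := fun i => by ring
  simpa only [e1, e2] using this

lemma IsLSE.convex_reflect {n : ℕ} {x y : Fin n → ℝ} {f : ℝ → ℝ}
    (h : IsLSE convexModel x y f) :
    IsLSE convexModel (fun i => 1 - x i) y (fun t => f (1 - t)) := by
  refine ⟨convexModel_reflect h.1, isMinOn_iff.2 fun g hg => ?_⟩
  have := isMinOn_iff.1 h.2 _ (convexModel_reflect hg)
  simpa only [sub_sub_cancel] using this

lemma IsCanonicalConvexLSE.reflect {n : ℕ} {x y : Fin n → ℝ} {f : ℝ → ℝ}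
    (h : IsCanonicalConvexLSE x y f) :
    IsCanonicalConvexLSE (fun i => 1 - x i) y (fun t => f (1 - t)) := by
  refine ⟨h.isLSE.convex_reflect, ?_, fun s t hs hst ht hx => ?_⟩
  · exact h.continuousOn.comp (by fun_prop) fun t ht => one_sub_mem_Icc ht
  · obtain ⟨a, b, hab⟩ := h.piecewise_linear (1 - t) (1 - s) (by linarith) (by linarith)
      (by linarith) fun i hi => by
        rcases hx i ⟨by linarith [hi.2], by linarith [hi.1]⟩ with h | h
        · exact Or.inr fun j => by linarith [h j]
        · exact Or.inl fun j => by linarith [h j]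
    refine ⟨-a, a + b, fun u hu => ?_⟩
    rw [hab (1 - u) ⟨by linarith [hu.2], by linarith [hu.1]⟩]
    ring

/-! ### Errors averaged with monotone weights -/

/-- Averages of `ξ` with non-negative weights that decrease in `x` are bounded by `K`. -/
def NoiseControlled {n : ℕ} (x ξ : Fin n → ℝ) (K : ℝ) : Prop :=
  ∀ a : Fin n → ℝ, (∀ i, 0 ≤ a i) → (∀ i j, x i ≤ x j → a j ≤ a i) →
    |∑ i, a i * ξ i| ≤ K * ∑ i, a i

lemma NoiseControlled.mono {n : ℕ} {x ξ : Fin n → ℝ} {K K' : ℝ} (h : NoiseControlled x ξ K)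
    (hK : K ≤ K') : NoiseControlled x ξ K' := fun a ha0 ha =>
  (h a ha0 ha).trans (mul_le_mul_of_nonneg_right hK (Finset.sum_nonneg fun i _ => ha0 i))

/-- Abel summation in inductive form: the invariant `key` survives each step because lowering the
weight on a non-negative partial sum only decreases it. -/
lemma sum_antitone_mul_nonneg {a η : ℕ → ℝ} (ha : Antitone a) (ha0 : ∀ i, 0 ≤ a i) {n : ℕ}
    (hη : ∀ j ≤ n, 0 ≤ ∑ i ∈ Finset.range j, η i) :
    0 ≤ ∑ i ∈ Finset.range n, a i * η i := by
  have key : ∀ m ≤ n, a m * ∑ i ∈ Finset.range m, η i ≤ ∑ i ∈ Finset.range m, a i * η i := by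
    intro m
    induction m with
    | zero => simp
    | succ m ih =>
      intro hm
      have h1 := ih (by omega)
      have h2 := mul_le_mul_of_nonneg_right (ha (Nat.le_succ m)) (hη (m + 1) hm)
      rw [Finset.sum_range_succ] at h2 ⊢
      rw [Finset.sum_range_succ]
      simp only [Nat.succ_eq_add_one] at h2
      linarith
  exact (mul_nonneg (ha0 n) (hη n le_rfl)).trans (key n le_rfl)

/-- The sum of the first `j` entries of a tuple. -/
def prefixSum {n : ℕ} (z : Fin n → ℝ) (j : ℕ) : ℝ :=
  ∑ i ∈ Finset.range j, if h : i < n then z ⟨i, h⟩ else 0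

lemma sum_antitone_mul_le {n : ℕ} {a z : Fin n → ℝ} {K : ℝ} (ha : Antitone a)
    (ha0 : ∀ i, 0 ≤ a i) (hz : ∀ j ≤ n, prefixSum z j ≤ K * j) :
    ∑ i, a i * z i ≤ K * ∑ i, a i := by
  -- Extending the weights by `0` beyond `n` keeps them antitone because they are non-negative.
  have h := sum_antitone_mul_nonneg (a := fun i => if h : i < n then a ⟨i, h⟩ else 0)
    (η := fun i => K - if h : i < n then z ⟨i, h⟩ else 0) (n := n) ?_ ?_ ?_
  · rw [Finset.sum_range] at h
    simp only [Fin.is_lt, dite_true, Fin.eta, mul_sub, Finset.sum_sub_distrib] at h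
    rw [Finset.mul_sum]
    simp only [mul_comm K]
    linarith
  · intro i j hij
    by_cases hj : j < n
    · simp only [hj, lt_of_le_of_lt hij hj, dite_true]
      exact ha hij
    · simp only [hj, dite_false]
      split_ifs <;> simp [ha0]
  · intro i
    split_ifs <;> simp [ha0]
  · intro j hj
    have := hz j hj
    rw [prefixSum] at this
    rw [Finset.sum_sub_distrib]
    simp only [Finset.sum_const, Finset.card_range, nsmul_eq_mul]
    linarith

lemma noiseControlled_of_prefixSum {n : ℕ} {x ξ : Fin n → ℝ} {K : ℝ} {σ : Equiv.Perm (Fin n)}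
    (hσ : Monotone (x ∘ σ)) (hξ : ∀ j ≤ n, |prefixSum (ξ ∘ σ) j| ≤ K * j) :
    NoiseControlled x ξ K := by
  intro a ha0 ha
  have hanti : Antitone (a ∘ σ) := fun i j hij => ha _ _ (hσ hij)
  have h1 := sum_antitone_mul_le (a := a ∘ σ) (z := ξ ∘ σ) hanti (fun i => ha0 _)
    fun j hj => (abs_le.1 (hξ j hj)).2
  have h2 := sum_antitone_mul_le (a := a ∘ σ) (z := fun i => -(ξ ∘ σ) i) (K := K) hanti
    (fun i => ha0 _) fun j hj => by
      have : prefixSum (fun i => -(ξ ∘ σ) i) j = -prefixSum (ξ ∘ σ) j := by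
        rw [prefixSum, prefixSum, ← Finset.sum_neg_distrib]
        refine Finset.sum_congr rfl fun i _ => ?_
        split_ifs <;> simp
      rw [this]
      linarith [(abs_le.1 (hξ j hj)).1]
  simp only [Function.comp_apply] at h1 h2
  rw [Equiv.sum_comp σ (fun i => a i * ξ i), Equiv.sum_comp σ a] at h1
  rw [Equiv.sum_comp σ (fun i => a i * -ξ i), Equiv.sum_comp σ a] at h2
  simp only [mul_neg, Finset.sum_neg_distrib] at h2
  exact abs_le.2 ⟨by linarith, h1⟩

/-! ### Isotonic least squares -/

/-- The competitor is `max f c`. Its excess `a` over `f` is non-negative and decreasing in the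
design, and wherever `a > 0` the residual is at least `a + ξ + K`. Noise control cancels `K` against
the errors and leaves `∑ a² ≤ 0`. -/
lemma IsLSE.isotonic_lower {n : ℕ} {x b ξ : Fin n → ℝ} {f : ℝ → ℝ} {M K : ℝ}
    (h : IsLSE isotonicModel x (fun i => b i + ξ i) f) (hx : ∀ i, x i ∈ Icc (0 : ℝ) 1)
    (hb : ∀ i, |b i| ≤ M) (hξ : NoiseControlled x ξ K) (i : Fin n) : -(M + K) ≤ f (x i) := by
  set c := -(M + K) with hc
  have hg : (fun t => max (f t) c) ∈ isotonicModel := fun s hs t ht hst =>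
    max_le_max_right c (h.1 hs ht hst)
  have hvar := h.sum_mul_sub_nonpos convex_isotonicModel hg
  set a : Fin n → ℝ := fun i => max (f (x i)) c - f (x i) with ha
  have ha0 : ∀ i, 0 ≤ a i := fun i => sub_nonneg.2 (le_max_left _ _)
  have hnoise := hξ a ha0 fun i j hij => by
    have := h.1 (hx i) (hx j) hij
    simp only [ha]
    rcases max_cases (f (x i)) c with h1 | h1 <;> rcases max_cases (f (x j)) c with h2 | h2 <;>
      linarith
  have hsq : ∑ i, a i ^ 2 ≤ 0 := by
    have hterm : ∀ i, a i ^ 2 + a i * ξ i + K * a i ≤ (b i + ξ i - f (x i)) * a i := by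
      intro i
      have h1 := mul_le_mul_of_nonneg_right (neg_le_of_abs_le (hb i)) (ha0 i)
      have h2 : (a i - (c - f (x i))) * a i = 0 := by
        simp only [ha]
        rcases max_cases (f (x i)) c with h1 | h1 <;> rw [h1.1] <;> ring
      rw [hc] at h2
      linarith
    have := (Finset.sum_le_sum fun i (_ : i ∈ Finset.univ) => hterm i).trans hvar
    rw [Finset.sum_add_distrib, Finset.sum_add_distrib, ← Finset.mul_sum] at this
    linarith [(abs_le.1 hnoise).1]
  have h0 := (Finset.sum_eq_zero_iff_of_nonneg fun i _ => sq_nonneg (a i)).1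
    (le_antisymm hsq (Finset.sum_nonneg fun i _ => sq_nonneg (a i))) i (Finset.mem_univ i)
  have := pow_eq_zero_iff two_ne_zero |>.1 h0
  simp only [ha, sub_eq_zero] at this
  exact this ▸ le_max_right _ _

lemma noiseControlled_neg {n : ℕ} {x ξ : Fin n → ℝ} {K : ℝ} (h : NoiseControlled x ξ K) :
    NoiseControlled x (fun i => -ξ i) K := fun a ha0 ha => by
  simpa only [mul_neg, Finset.sum_neg_distrib, abs_neg] using h a ha0 ha

lemma IsLSE.isotonic_abs_le {n : ℕ} {x b ξ : Fin n → ℝ} {f : ℝ → ℝ} {M K : ℝ}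
    (h : IsLSE isotonicModel x (fun i => b i + ξ i) f) (hx : ∀ i, x i ∈ Icc (0 : ℝ) 1)
    (hb : ∀ i, |b i| ≤ M) (hξ : NoiseControlled x ξ K)
    (hξ' : NoiseControlled (fun i => 1 - x i) ξ K) (i : Fin n) : |f (x i)| ≤ M + K := by
  have h' : IsLSE isotonicModel (fun i => 1 - x i) (fun i => -b i + -ξ i)
      (fun t => -f (1 - t)) := by
    simpa only [neg_add] using h.isotonic_reflect
  have h1 := h.isotonic_lower hx hb hξ i
  have h2 := h'.isotonic_lower (fun i => one_sub_mem_Icc (hx i))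
    (fun i => (abs_neg (b i)).trans_le (hb i)) (noiseControlled_neg hξ') i
  rw [sub_sub_cancel] at h2
  exact abs_le.2 ⟨h1, by linarith⟩

/-- The canonical isotonic estimator takes its extreme values on `[0,1]` at design points. -/
lemma IsCanonicalIsotonicLSE.abs_le {n : ℕ} (hn : 1 ≤ n) {x y : Fin n → ℝ} {f : ℝ → ℝ} {B : ℝ}
    (h : IsCanonicalIsotonicLSE x y f) (hx : ∀ i, x i ∈ Icc (0 : ℝ) 1)
    (hB : ∀ i, |f (x i)| ≤ B) {t : ℝ} (ht : t ∈ Icc (0 : ℝ) 1) : |f t| ≤ B := by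
  have : Nonempty (Fin n) := ⟨⟨0, hn⟩⟩
  obtain ⟨p, hp⟩ := Finite.exists_min x
  obtain ⟨q, hq⟩ := Finite.exists_max x
  have h0 : (0 : ℝ) ∈ Icc (0 : ℝ) 1 := ⟨le_rfl, zero_le_one⟩
  have h1 : (1 : ℝ) ∈ Icc (0 : ℝ) 1 := ⟨zero_le_one, le_rfl⟩
  have hright : f (x q) = f 1 :=
    h.piecewise_constant _ _ (hx q).1 (hx q).2 le_rfl fun i hi j => (hq j).trans hi.1
  have hleft : f (x p) = f 0 := by
    rcases (hx p).1.eq_or_lt with h00 | hpos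
    · rw [← h00]
    -- A jump at the smallest design point is allowed, but left-continuity gives `f` there the value
    -- from the left.
    have hev : ∀ s ∈ Ico 0 (x p), f s = f 0 := fun s hs =>
      (h.piecewise_constant 0 s le_rfl hs.1 (hs.2.le.trans (hx p).2) fun i hi =>
        absurd (hp i) (not_le.2 (lt_of_le_of_lt hi.2 hs.2))).symm
    have hc : Tendsto f (nhdsWithin (x p) (Ico 0 (x p))) (nhds (f (x p))) :=
      (h.left_continuous _ (hx p)).mono Ico_subset_Icc_self
    have hc' : Tendsto f (nhdsWithin (x p) (Ico 0 (x p))) (nhds (f 0)) :=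
      tendsto_const_nhds.congr' (eventually_nhdsWithin_of_forall fun s hs => (hev s hs).symm)
    have : (nhdsWithin (x p) (Ico 0 (x p))).NeBot := by
      rw [← mem_closure_iff_nhdsWithin_neBot, closure_Ico hpos.ne]
      exact right_mem_Icc.2 hpos.le
    exact tendsto_nhds_unique hc hc'
  have hm1 := h.isLSE.1 h0 ht ht.1
  have hm2 := h.isLSE.1 ht h1 ht.2
  exact _root_.abs_le.2 ⟨by linarith [(_root_.abs_le.1 (hB p)).1],
    by linarith [(_root_.abs_le.1 (hB q)).2]⟩

/-! ### Convex functions on the unit interval -/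

/-- `f` coincides with an affine function on `[s,t]`. -/
def AffineOnIcc (f : ℝ → ℝ) (s t : ℝ) : Prop := ∃ a b : ℝ, ∀ u ∈ Icc s t, f u = a * u + b

lemma AffineOnIcc.glue {f : ℝ → ℝ} {r s t u : ℝ} (h1 : AffineOnIcc f r t)
    (h2 : AffineOnIcc f s u) (hrs : r ≤ s) (hst : s < t) (htu : t ≤ u) : AffineOnIcc f r u := by
  obtain ⟨a, b, hab⟩ := h1
  obtain ⟨c, d, hcd⟩ := h2
  have e1 := (hab s ⟨hrs, hst.le⟩).symm.trans (hcd s ⟨le_rfl, hst.le.trans htu⟩)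
  have e2 := (hab t ⟨hrs.trans hst.le, le_rfl⟩).symm.trans (hcd t ⟨hst.le, htu⟩)
  have hac : a = c := by
    have : (a - c) * (t - s) = 0 := by linarith
    rcases mul_eq_zero.1 this with h | h <;> linarith
  subst hac
  have hbd : b = d := by linarith
  subst hbd
  refine ⟨a, b, fun v hv => ?_⟩
  rcases le_total v t with h | h
  · exact hab v ⟨hv.1, h⟩
  · exact hcd v ⟨hst.le.trans h, hv.2⟩

/-- The chord from `p` to `q` has slope at most `2D / (1/8) = 16D`. To the left of `p` the slopes
are no larger, so `f` loses at most `16D` from a value that is at least `-D`. -/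
lemma ConvexOn.lower_extrapolation {f : ℝ → ℝ} (hf : ConvexOn ℝ (Icc 0 1) f) {t p q D : ℝ}
    (ht : t ∈ Icc (0 : ℝ) 1) (hq : q ∈ Icc (0 : ℝ) 1) (htp : t ≤ p)
    (hpq : p + 1 / 8 ≤ q) (hfp : |f p| ≤ D) (hfq : |f q| ≤ D) : -(17 * D) ≤ f t := by
  have hD : 0 ≤ D := (abs_nonneg _).trans hfp
  have hp1 := (abs_le.1 hfp).1
  rcases htp.eq_or_lt with rfl | hlt
  · linarith
  have hs := hf.slope_mono_adjacent ht hq hlt (by linarith : p < q)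
  have h2 : (f q - f p) / (q - p) ≤ 16 * D := by
    rw [div_le_iff₀ (by linarith)]
    nlinarith [(abs_le.1 hfq).2]
  have h3 := (div_le_iff₀ (by linarith)).1 (hs.trans h2)
  nlinarith [ht.1, hq.2, ht.2]

/-- Replacing a convex function to the left of `τ` by an affine minorant that touches it at `τ`
preserves convexity. -/
lemma ConvexOn.ite_affine {f : ℝ → ℝ} (hf : ConvexOn ℝ (Icc 0 1) f) {τ a b : ℝ}
    (hτ : τ ∈ Icc (0 : ℝ) 1) (hfτ : f τ = a * τ + b)
    (hle : ∀ u ∈ Icc τ 1, a * u + b ≤ f u) :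
    ConvexOn ℝ (Icc 0 1) (fun u => if u < τ then a * u + b else f u) := by
  refine convexOn_of_slope_mono_adjacent (convex_Icc 0 1) fun {x y z} hx hz hxy hyz => ?_
  have hle' : ∀ u, τ ≤ u → u ≤ 1 → a * u + b ≤ f u := fun u h h' => hle u ⟨h, h'⟩
  have aff : ∀ u v : ℝ, u < v → (a * v + b - (a * u + b)) / (v - u) = a := fun u v huv => by
    rw [div_eq_iff (by linarith)]; ring
  by_cases hyτ : y < τ
  · simp only [hyτ, hxy.trans hyτ, if_true]
    rw [aff x y hxy, le_div_iff₀ (by linarith)]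
    split_ifs with hzτ
    · linarith
    · linarith [hle' z (not_lt.1 hzτ) hz.2]
  · have hzτ : ¬ z < τ := fun h => hyτ (hyz.trans h)
    simp only [hyτ, hzτ, if_false]
    split_ifs with hxτ
    · have hfz := hle' z (not_lt.1 hzτ) hz.2
      have hfy := hle' y (not_lt.1 hyτ) (hyz.le.trans hz.2)
      rcases (not_lt.1 hyτ).eq_or_lt with rfl | hlt
      · rw [hfτ, aff x _ hxy, le_div_iff₀ (by linarith)]
        linarith
      have hs := hf.slope_mono_adjacent hτ hz hlt hyz
      refine le_trans ?_ hs
      rw [div_le_div_iff₀ (by linarith) (by linarith), hfτ]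
      nlinarith
    · exact hf.slope_mono_adjacent hx hz hxy hyz

/-! ### The first kink of the canonical convex estimator -/

/-- Either the canonical convex estimator is affine on `[0,1]`, or it has a first kink, at a design
point `x k` which is not the smallest one, and that kink can be smoothed out from the left. -/
lemma IsCanonicalConvexLSE.affine_or_exists_kink {n : ℕ} (hn : 1 ≤ n) {x y : Fin n → ℝ}
    {f : ℝ → ℝ} (h : IsCanonicalConvexLSE x y f) (hx : ∀ i, x i ∈ Icc (0 : ℝ) 1) :
    AffineOnIcc f 0 1 ∨ ∃ k, (∃ i, x i < x k) ∧ AffineOnIcc f 0 (x k) ∧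
      ∃ g ∈ convexModel, ∃ c > 0, ∀ u ∈ Icc (0 : ℝ) 1, f u - g u = c * max 0 (x k - u) := by
  classical
  have : Nonempty (Fin n) := ⟨⟨0, hn⟩⟩
  obtain ⟨p, hp⟩ := Finite.exists_min x
  have hpJ : AffineOnIcc f 0 (x p) := h.piecewise_linear 0 (x p) le_rfl (hx p).1 (hx p).2
    fun i hi => absurd (hp i) (not_le.2 hi.2)
  -- The first kink is the rightmost design point up to which `f` is still affine from `0`.
  obtain ⟨k, hkJ, hk⟩ := Finset.exists_max_image
    (Finset.univ.filter fun i => AffineOnIcc f 0 (x i)) x ⟨p, by simpa using hpJ⟩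
  simp only [Finset.mem_filter, Finset.mem_univ, true_and] at hkJ hk
  by_cases hmax : ∀ j, x j ≤ x k
  · left
    by_cases hprev : ∃ i, x i < x k
    · obtain ⟨i, hi⟩ := hprev
      obtain ⟨r, hr, hrmax⟩ := Finset.exists_max_image
        (Finset.univ.filter fun i => x i < x k) x ⟨i, by simpa using hi⟩
      simp only [Finset.mem_filter, Finset.mem_univ, true_and] at hr hrmax
      -- No kink is allowed at the largest point, so the piece starting at the preceding distinct
      -- design value runs to `1` and overlaps the first piece.
      have h2 : AffineOnIcc f (x r) 1 := h.piecewise_linear _ _ (hx r).1 (hx r).2 le_rfl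
        fun j hj => Or.inr fun l => (hmax l).trans <| by
          by_contra hlt
          exact absurd (hrmax j (not_le.1 hlt)) (not_le.2 hj.1)
      exact hkJ.glue h2 (hx r).1 hr (hx k).2
    · push Not at hprev
      exact h.piecewise_linear 0 1 le_rfl zero_le_one le_rfl fun j _ =>
        Or.inr fun l => (hmax l).trans (hprev j)
  · push Not at hmax
    obtain ⟨j, hj⟩ := hmax
    obtain ⟨r, hr, hrmin⟩ := Finset.exists_min_image
      (Finset.univ.filter fun i => x k < x i) x ⟨j, by simpa using hj⟩
    simp only [Finset.mem_filter, Finset.mem_univ, true_and] at hr hrmin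
    have hnot : ¬ AffineOnIcc f 0 (x r) := fun hA => absurd (hk r hA) (not_le.2 hr)
    have hprev : ∃ i, x i < x k := by
      by_contra hno
      push Not at hno
      exact hnot <| h.piecewise_linear 0 (x r) le_rfl (hx r).1 (hx r).2 fun i hi =>
        Or.inl fun l => le_trans (by
          by_contra hlt
          exact absurd (hrmin i (not_le.1 hlt)) (not_le.2 hi.2)) (hno l)
    have hnext : AffineOnIcc f (x k) (x r) := h.piecewise_linear _ _ (hx k).1 hr.le (hx r).2
      fun i hi => absurd (hrmin i hi.1) (not_le.2 hi.2)
    right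
    refine ⟨k, hprev, hkJ, ?_⟩
    have hconv : ConvexOn ℝ (Icc 0 1) f := h.isLSE.1
    obtain ⟨a, b, hab⟩ := hkJ
    obtain ⟨c, d, hcd⟩ := hnext
    have hkpos : 0 < x k := by
      obtain ⟨i, hi⟩ := hprev
      exact (hx i).1.trans_lt hi
    have e1 := hab (x k) ⟨hkpos.le, le_rfl⟩
    have e2 := hcd (x k) ⟨le_rfl, hr.le⟩
    have e3 := hcd (x r) ⟨hr.le, le_rfl⟩
    have e0 := hab 0 ⟨le_rfl, hkpos.le⟩
    have hac : a ≤ c := by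
      have hs := hconv.slope_mono_adjacent ⟨le_rfl, zero_le_one⟩ (hx r) hkpos hr
      have s1 : (f (x k) - f 0) / (x k - 0) = a := by
        rw [e1, e0, div_eq_iff (by linarith)]; ring
      have s2 : (f (x r) - f (x k)) / (x r - x k) = c := by
        rw [e3, e2, div_eq_iff (by linarith)]; ring
      rwa [s1, s2] at hs
    have hac' : a < c := by
      refine hac.lt_of_ne fun heq => hnot ⟨a, b, fun u hu => ?_⟩
      subst heq
      rcases le_total u (x k) with hu' | hu'
      · exact hab u ⟨hu.1, hu'⟩
      · rw [hcd u ⟨hu', hu.2⟩]; linarith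
    -- The second linear piece is extended to the left as far as `0`; the constant is the jump of
    -- slope at the kink.
    refine ⟨fun u => if u < x k then c * u + d else f u,
      hconv.ite_affine (hx k) e2 fun u hu => ?_, c - a, by linarith, fun u hu => ?_⟩
    · rcases le_or_gt u (x r) with hu' | hu'
      · exact (hcd u ⟨hu.1, hu'⟩).ge
      · have hs := hconv.slope_mono_adjacent (hx k) ⟨(hx r).1.trans hu'.le, hu.2⟩ hr hu'
        have s2 : (f (x r) - f (x k)) / (x r - x k) = c := by
          rw [e3, e2, div_eq_iff (by linarith)]; ring
        rw [s2, le_div_iff₀ (by linarith)] at hs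
        linarith
    · dsimp only
      split_ifs with hlt
      · rw [max_eq_right (by linarith), hab u ⟨hu.1, hlt.le⟩]
        linear_combination e2 - e1
      · rw [max_eq_left (by linarith)]; ring

/-! ### Bounds for the canonical convex estimator -/

/-- The design points below any design point do not cluster at that point. -/
def SpreadBelow {n : ℕ} (x : Fin n → ℝ) (δ : ℝ) : Prop :=
  ∀ k, (∃ i, x i < x k) →
    δ * ∑ i, (if x i < x k then (1 : ℝ) else 0) ≤ ∑ i, max 0 (1 - x i / x k)

lemma SpreadBelow.mono {n : ℕ} {x : Fin n → ℝ} {δ δ' : ℝ} (h : SpreadBelow x δ) (hδ : δ' ≤ δ) :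
    SpreadBelow x δ' := fun k hk =>
  (mul_le_mul_of_nonneg_right hδ (Finset.sum_nonneg fun i _ => by
    split_ifs <;> norm_num)).trans (h k hk)

/-- Smoothing out the first kink `τ` shows that the residuals have non-negative sum against `w = max
0 (1 - x / τ)`. Where `w > 0`, `f` interpolates as `f 0 * w + f τ * (1 - w)`, so this inequality
bounds `f 0 * ∑ w²` by `(M + K + C) * ∑ w`. -/
lemma IsCanonicalConvexLSE.left_end_le {n : ℕ} (hn : 1 ≤ n) {x b ξ : Fin n → ℝ} {f : ℝ → ℝ}
    {M K C δ : ℝ} (h : IsCanonicalConvexLSE x (fun i => b i + ξ i) f)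
    (hx : ∀ i, x i ∈ Icc (0 : ℝ) 1) (hb : ∀ i, |b i| ≤ M) (hξ : NoiseControlled x ξ K)
    (hδ : 0 < δ) (hspread : SpreadBelow x δ) (hC : 0 ≤ C) (hlow : ∀ t ∈ Icc (0 : ℝ) 1, -C ≤ f t) :
    AffineOnIcc f 0 1 ∨ f 0 ≤ (M + K + C) / δ := by
  rcases h.affine_or_exists_kink hn hx with haff | ⟨k, ⟨i₀, hi₀⟩, ⟨a, d, had⟩, g, hg, c, hc, hfg⟩
  · exact Or.inl haff
  right
  set τ := x k with hτ
  have hτ0 : 0 < τ := (hx i₀).1.trans_lt hi₀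
  set w : Fin n → ℝ := fun i => max 0 (1 - x i / τ) with hw
  have hw0 : ∀ i, 0 ≤ w i := fun i => le_max_left _ _
  have hwanti : ∀ i j, x i ≤ x j → w j ≤ w i := fun i j hij => by
    simp only [hw]
    gcongr
  have hvar := h.isLSE.sum_mul_sub_nonpos convex_convexModel hg
  have hRw : 0 ≤ ∑ i, (b i + ξ i - f (x i)) * w i := by
    have e : ∑ i, (b i + ξ i - f (x i)) * (g (x i) - f (x i))
        = -(c * τ) * ∑ i, (b i + ξ i - f (x i)) * w i := by
      rw [Finset.mul_sum]
      refine Finset.sum_congr rfl fun i _ => ?_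
      have h1 := hfg (x i) (hx i)
      have h2 : max 0 (τ - x i) = τ * w i := by
        rw [hw, mul_max_of_nonneg _ _ hτ0.le]
        congr 1
        · ring
        · field_simp
      rw [h2] at h1
      linear_combination -(b i + ξ i - f (x i)) * h1
    rw [e] at hvar
    have : 0 < c * τ := by positivity
    nlinarith
  have hfτ := hlow τ (hx k)
  have hterm : ∀ i, (b i + ξ i - f (x i)) * w i ≤ (M + C) * w i + w i * ξ i - f 0 * w i ^ 2 := by
    intro i
    have h1 := mul_le_mul_of_nonneg_right (le_of_abs_le (hb i)) (hw0 i)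
    have h2 : (f (x i) - (f 0 * w i + f τ * (1 - w i))) * w i = 0 := by
      rcases lt_or_ge (x i) τ with hlt | hge
      · have : w i = 1 - x i / τ := max_eq_right (by
          rw [sub_nonneg, div_le_one hτ0]; exact hlt.le)
        rw [had (x i) ⟨(hx i).1, hlt.le⟩, had 0 ⟨le_rfl, hτ0.le⟩, had τ ⟨hτ0.le, le_rfl⟩, this]
        field_simp
        ring
      · have : w i = 0 := max_eq_left (by
          rw [sub_nonpos, one_le_div hτ0]; exact hge)
        rw [this, mul_zero]
    have hw1 : w i ≤ 1 := max_le zero_le_one (by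
      have := div_nonneg (hx i).1 hτ0.le
      linarith)
    have h3 : -C * ((1 - w i) * w i) ≤ f τ * ((1 - w i) * w i) :=
      mul_le_mul_of_nonneg_right hfτ (mul_nonneg (by linarith) (hw0 i))
    have h4 : 0 ≤ C * w i ^ 2 := by positivity
    nlinarith
  have hsum := hRw.trans (Finset.sum_le_sum fun i _ => hterm i)
  rw [Finset.sum_sub_distrib, Finset.sum_add_distrib, ← Finset.mul_sum, ← Finset.mul_sum] at hsum
  have hnoise := (abs_le.1 (hξ w hw0 hwanti)).2
  set W := ∑ i, w i with hW
  set m := ∑ i, (if x i < τ then (1 : ℝ) else 0) with hm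
  have hWpos : 0 < W := Finset.sum_pos' (fun i _ => hw0 i) ⟨i₀, Finset.mem_univ _, by
    refine lt_of_lt_of_le ?_ (le_max_right _ _)
    rw [sub_pos, div_lt_one hτ0]; exact hi₀⟩
  have hWm : δ * m ≤ W := hspread k ⟨i₀, hi₀⟩
  -- Cauchy–Schwarz on the `m` points below `τ`; together with `δ * m ≤ W` it gives `δ * W ≤ ∑ w²`.
  have hCS : W ^ 2 ≤ m * ∑ i, w i ^ 2 := by
    have := Finset.sum_mul_sq_le_sq_mul_sq Finset.univ
      (fun i => if x i < τ then (1 : ℝ) else 0) w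
    have e1 : ∀ i, (if x i < τ then (1 : ℝ) else 0) * w i = w i := fun i => by
      split_ifs with hlt
      · rw [one_mul]
      · rw [zero_mul]
        exact (max_eq_left (by rw [sub_nonpos, one_le_div hτ0]; exact not_lt.1 hlt)).symm
    simpa only [e1, ite_pow, one_pow, ne_eq, OfNat.ofNat_ne_zero, not_false_eq_true, zero_pow]
      using this
  have hsq : δ * W ≤ ∑ i, w i ^ 2 := by
    have hS : 0 ≤ ∑ i, w i ^ 2 := Finset.sum_nonneg fun i _ => sq_nonneg _
    have : W * (δ * W) ≤ W * ∑ i, w i ^ 2 := by nlinarith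
    exact le_of_mul_le_mul_left this hWpos
  rw [le_div_iff₀ hδ]
  rcases le_or_gt (f 0) 0 with hneg | hpos
  · have : 0 ≤ M + K + C := by
      have hM : 0 ≤ M := (abs_nonneg _).trans (hb k)
      have : 0 ≤ K * W := (abs_nonneg _).trans (hξ w hw0 hwanti)
      have : 0 ≤ K := nonneg_of_mul_nonneg_left this hWpos
      positivity
    nlinarith
  · have h5 : W * (f 0 * δ) ≤ W * (M + K + C) := by nlinarith
    exact le_of_mul_le_mul_left h5 hWpos

/-- Each of four separated subintervals of `[0,1]` contains a point where `|f| ≤ D`. -/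
def BoundedSomewhere (f : ℝ → ℝ) (D : ℝ) : Prop :=
  (∃ p ∈ Icc (1 / 8 : ℝ) (1 / 4), |f p| ≤ D) ∧ (∃ p ∈ Icc (3 / 8 : ℝ) (1 / 2), |f p| ≤ D) ∧
  (∃ p ∈ Icc (1 / 2 : ℝ) (5 / 8), |f p| ≤ D) ∧ (∃ p ∈ Icc (3 / 4 : ℝ) (7 / 8), |f p| ≤ D)

lemma BoundedSomewhere.reflect {f : ℝ → ℝ} {D : ℝ} (h : BoundedSomewhere f D) :
    BoundedSomewhere (fun t => f (1 - t)) D := by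
  obtain ⟨⟨p, hp, hp'⟩, ⟨q, hq, hq'⟩, ⟨r, hr, hr'⟩, ⟨s, hs, hs'⟩⟩ := h
  refine ⟨⟨1 - s, ⟨?_, ?_⟩, ?_⟩, ⟨1 - r, ⟨?_, ?_⟩, ?_⟩, ⟨1 - q, ⟨?_, ?_⟩, ?_⟩,
    ⟨1 - p, ⟨?_, ?_⟩, ?_⟩⟩
  all_goals first
    | simpa only [sub_sub_cancel] using by assumption
    | linarith [hp.1, hp.2, hq.1, hq.2, hr.1, hr.2, hs.1, hs.2]

lemma BoundedSomewhere.neg {f : ℝ → ℝ} {D : ℝ} (h : BoundedSomewhere f D) :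
    BoundedSomewhere (fun t => -f t) D := by
  simpa only [BoundedSomewhere, abs_neg] using h

lemma BoundedSomewhere.lower {f : ℝ → ℝ} {D : ℝ} (h : BoundedSomewhere f D)
    (hf : f ∈ convexModel) {t : ℝ} (ht : t ∈ Icc (0 : ℝ) 1) : -(17 * D) ≤ f t := by
  have left : ∀ {f : ℝ → ℝ}, BoundedSomewhere f D → f ∈ convexModel → ∀ {t : ℝ},
      t ∈ Icc (0 : ℝ) 1 → t ≤ 1 / 2 → -(17 * D) ≤ f t := by
    intro f h hf t ht ht'
    -- The two intervals to the right of `1/2` are `1/8` apart, the gap that extrapolation requires.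
    obtain ⟨-, -, ⟨r, hr, hr'⟩, ⟨s, hs, hs'⟩⟩ := h
    exact ConvexOn.lower_extrapolation hf ht ⟨by linarith [hs.1], by linarith [hs.2]⟩
      (ht'.trans hr.1) (by linarith [hs.1, hr.2]) hr' hs'
  rcases le_total t (1 / 2) with ht' | ht'
  · exact left h hf ht ht'
  · have := left h.reflect (convexModel_reflect hf) (one_sub_mem_Icc ht) (by linarith)
    simpa only [sub_sub_cancel] using this

/-- When there is no kink, this turns the lower bound for convex functions, applied to `-f`, into an
upper bound for `f`. -/
lemma AffineOnIcc.neg_mem_convexModel {f : ℝ → ℝ} (h : AffineOnIcc f 0 1) :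
    (fun t => -f t) ∈ convexModel := by
  obtain ⟨a, b, hab⟩ := h
  refine ⟨convex_Icc 0 1, fun s hs t ht p q hp hq hpq => le_of_eq ?_⟩
  have hmem := convex_Icc (0 : ℝ) 1 hs ht hp hq hpq
  simp only [smul_eq_mul] at hmem ⊢
  rw [hab _ hmem, hab _ hs, hab _ ht]
  linear_combination b * hpq

lemma IsCanonicalConvexLSE.abs_le {n : ℕ} (hn : 1 ≤ n) {x b ξ : Fin n → ℝ} {f : ℝ → ℝ}
    {M K D δ : ℝ} (h : IsCanonicalConvexLSE x (fun i => b i + ξ i) f)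
    (hx : ∀ i, x i ∈ Icc (0 : ℝ) 1) (hb : ∀ i, |b i| ≤ M) (hξ : NoiseControlled x ξ K)
    (hξ' : NoiseControlled (fun i => 1 - x i) ξ K) (hδ : 0 < δ) (hspread : SpreadBelow x δ)
    (hspread' : SpreadBelow (fun i => 1 - x i) δ) (hD : BoundedSomewhere f D) {t : ℝ}
    (ht : t ∈ Icc (0 : ℝ) 1) : |f t| ≤ max (17 * D) ((M + K + 17 * D) / δ) := by
  have hD0 : 0 ≤ D := by
    obtain ⟨⟨p, -, hp⟩, -⟩ := hD
    exact (abs_nonneg _).trans hp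
  have left : ∀ {x : Fin n → ℝ} {f : ℝ → ℝ}, IsCanonicalConvexLSE x (fun i => b i + ξ i) f →
      (∀ i, x i ∈ Icc (0 : ℝ) 1) → NoiseControlled x ξ K → SpreadBelow x δ →
      BoundedSomewhere f D → f 0 ≤ max (17 * D) ((M + K + 17 * D) / δ) := by
    intro x f h hx hξ hspread hD
    rcases h.left_end_le hn hx hb hξ hδ hspread (by positivity)
      (fun t ht => hD.lower h.isLSE.1 ht) with haff | hle
    · have := hD.neg.lower haff.neg_mem_convexModel (t := 0) ⟨le_rfl, zero_le_one⟩
      exact le_max_of_le_left (by linarith)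
    · exact le_max_of_le_right hle
  have h0 := left h hx hξ hspread hD
  have h1 := left h.reflect (fun i => one_sub_mem_Icc (hx i)) hξ' hspread' hD.reflect
  simp only [sub_zero] at h1
  refine _root_.abs_le.2 ⟨(neg_le_neg (le_max_left _ _)).trans (hD.lower h.isLSE.1 ht), ?_⟩
  have hconv : ConvexOn ℝ (Icc 0 1) f := h.isLSE.1
  exact (hconv.le_max_of_mem_Icc ⟨le_rfl, zero_le_one⟩ ⟨zero_le_one, le_rfl⟩ ht).trans
    (max_le h0 h1)

/-! ### Uniform design points do not cluster -/

/-- The uniform distribution on `[0,1]`. -/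
noncomputable def unif : Measure ℝ := volume.restrict (Icc 0 1)

instance : IsProbabilityMeasure unif := ⟨by simp [unif]⟩

lemma lintegral_pi_prod_eq {n : ℕ} (ν : Measure ℝ) [IsProbabilityMeasure ν] {f : ℝ → ℝ≥0∞}
    (hf : Measurable f) :
    ∫⁻ x, ∏ i, f (x i) ∂(Measure.pi fun _ : Fin n => ν) = (∫⁻ t, f t ∂ν) ^ n := by
  have hind : iIndepFun (fun (i : Fin n) (x : Fin n → ℝ) => f (x i))
      (Measure.pi fun _ : Fin n => ν) :=
    iIndepFun_pi (X := fun _ => f) fun _ => hf.aemeasurable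
  have h := lintegral_prod_eq_prod_lintegral_of_indepFun Finset.univ _ hind
    (fun i => hf.comp (measurable_pi_apply i))
  rw [h]
  have h2 : ∀ i : Fin n, ∫⁻ x, f (x i) ∂(Measure.pi fun _ : Fin n => ν) = ∫⁻ t, f t ∂ν :=
    fun i => (measurePreserving_eval (fun _ : Fin n => ν) i).lintegral_comp hf
  simp [h2]

/-- The exponential tilt used to detect clusters of points just below `t`. -/
noncomputable def tilt (δ t x : ℝ) : ℝ := if x < t then 1 - (1 - x / t) / δ else 0

lemma measurable_tilt (δ : ℝ) : Measurable fun p : ℝ × ℝ => tilt δ p.1 p.2 := by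
  unfold tilt
  refine Measurable.ite (measurableSet_lt measurable_snd measurable_fst) ?_ measurable_const
  fun_prop

/-- Points above `t` contribute `1 - t`. Those below contribute an exponential integral concentrated
just under `t`, at most `t * e * δ`. -/
lemma lintegral_exp_tilt_le {δ t : ℝ} (hδ : 0 < δ) (ht : 0 < t) (ht1 : t ≤ 1) :
    ∫⁻ x, ENNReal.ofReal (Real.exp (tilt δ t x)) ∂unif
      ≤ ENNReal.ofReal (1 - t * (1 - Real.exp 1 * δ)) := by
  have hsplit : Icc (0 : ℝ) 1 = Ico 0 t ∪ Icc t 1 := (Ico_union_Icc_eq_Icc ht.le ht1).symm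
  have h1 : ∫⁻ x in Ico 0 t, ENNReal.ofReal (Real.exp (tilt δ t x))
      ≤ ENNReal.ofReal (t * (Real.exp 1 * δ)) := by
    have hd : ∀ x ∈ uIcc 0 t, HasDerivAt
        (fun x => t * δ * Real.exp (1 - (1 - x / t) / δ)) (Real.exp (1 - (1 - x / t) / δ)) x := by
      intro x _
      have : HasDerivAt (fun x : ℝ => 1 - (1 - x / t) / δ) (1 / (t * δ)) x := by
        have := ((((hasDerivAt_id x).div_const t).const_sub 1).div_const δ).const_sub 1
        exact this.congr_deriv (by field_simp)
      exact (this.exp.const_mul (t * δ)).congr_deriv (by field_simp)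
    have hcont : Continuous fun x : ℝ => Real.exp (1 - (1 - x / t) / δ) := by fun_prop
    have hint := intervalIntegral.integral_eq_sub_of_hasDerivAt hd
      (hcont.intervalIntegrable 0 t)
    calc ∫⁻ x in Ico 0 t, ENNReal.ofReal (Real.exp (tilt δ t x))
        = ∫⁻ x in Ico 0 t, ENNReal.ofReal (Real.exp (1 - (1 - x / t) / δ)) :=
          setLIntegral_congr_fun measurableSet_Ico fun x hx => by simp [tilt, hx.2]
      _ = ∫⁻ x in Ioc 0 t, ENNReal.ofReal (Real.exp (1 - (1 - x / t) / δ)) := by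
          rw [restrict_Ico_eq_restrict_Ioc]
      _ = ENNReal.ofReal (∫ x in Ioc 0 t, Real.exp (1 - (1 - x / t) / δ)) :=
          (ofReal_integral_eq_lintegral_ofReal
            ((intervalIntegrable_iff_integrableOn_Ioc_of_le ht.le).1
              (hcont.intervalIntegrable 0 t)) (ae_of_all _ fun x => (Real.exp_pos _).le)).symm
      _ ≤ _ := by
          rw [← intervalIntegral.integral_of_le ht.le, hint]
          refine ENNReal.ofReal_le_ofReal ?_
          have e1 : (1 : ℝ) - (1 - t / t) / δ = 1 := by rw [div_self ht.ne']; simp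
          rw [e1]
          have : 0 ≤ t * δ * Real.exp (1 - (1 - 0 / t) / δ) := by positivity
          linarith
  have h2 : ∫⁻ x in Icc t 1, ENNReal.ofReal (Real.exp (tilt δ t x)) = ENNReal.ofReal (1 - t) := by
    rw [setLIntegral_congr_fun (g := fun _ => 1) measurableSet_Icc fun x hx => by
      simp [tilt, not_lt.2 hx.1]]
    simp
  rw [unif, hsplit]
  refine (lintegral_union_le _ _ _).trans ((add_le_add h1 h2.le).trans_eq ?_)
  rw [← ENNReal.ofReal_add (by positivity) (by linarith)]
  congr 1
  ring

lemma lintegral_one_sub_mul_pow_le {r : ℝ} (hr : 0 < r) (hr1 : r ≤ 1) (n : ℕ) :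
    ∫⁻ t, ENNReal.ofReal (1 - t * r) ^ n ∂unif ≤ ENNReal.ofReal (1 / ((n + 1) * r)) := by
  have hd : ∀ t ∈ uIcc (0 : ℝ) 1, HasDerivAt
      (fun t => -(1 / ((n + 1) * r)) * (1 - t * r) ^ (n + 1)) ((1 - t * r) ^ n) t := by
    intro t _
    have h0 : HasDerivAt (fun t : ℝ => 1 - t * r) (-r) t := by
      simpa using ((hasDerivAt_id t).mul_const r).const_sub 1
    refine ((h0.pow (n + 1)).const_mul (-(1 / ((n + 1) * r)))).congr_deriv ?_
    push_cast
    field_simp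
  have hcont : Continuous fun t : ℝ => (1 - t * r) ^ n := by fun_prop
  have hint := intervalIntegral.integral_eq_sub_of_hasDerivAt hd (hcont.intervalIntegrable 0 1)
  have hnn : ∀ t ∈ Ioc (0 : ℝ) 1, 0 ≤ 1 - t * r := fun t ht => by nlinarith [ht.1, ht.2]
  calc ∫⁻ t, ENNReal.ofReal (1 - t * r) ^ n ∂unif
      = ∫⁻ t in Ioc 0 1, ENNReal.ofReal ((1 - t * r) ^ n) := by
        rw [unif, ← restrict_Ioc_eq_restrict_Icc]
        exact setLIntegral_congr_fun measurableSet_Ioc fun t ht =>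
          (ENNReal.ofReal_pow (hnn t ht) n).symm
    _ = ENNReal.ofReal (∫ t in Ioc 0 1, (1 - t * r) ^ n) :=
        (ofReal_integral_eq_lintegral_ofReal
          ((intervalIntegrable_iff_integrableOn_Ioc_of_le zero_le_one).1
            (hcont.intervalIntegrable 0 1))
          ((ae_restrict_iff' measurableSet_Ioc).2
            (ae_of_all _ fun t ht => pow_nonneg (hnn t ht) n))).symm
    _ ≤ _ := by
        rw [← intervalIntegral.integral_of_le zero_le_one, hint]
        refine ENNReal.ofReal_le_ofReal ?_
        have : 0 ≤ 1 / ((n + 1) * r) * (1 - 1 * r) ^ (n + 1) :=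
          mul_nonneg (by positivity) (pow_nonneg (by linarith) _)
        simp only [zero_mul, sub_zero, one_pow]
        linarith

/-- The sum over all design points of the exponential tilts at that point. -/
noncomputable def tiltSum (δ : ℝ) {n : ℕ} (x : Fin n → ℝ) : ℝ≥0∞ :=
  ∑ k, ∏ i, ENNReal.ofReal (Real.exp (tilt δ (x k) (x i)))

lemma measurable_tiltSum (δ : ℝ) (n : ℕ) : Measurable (tiltSum δ (n := n)) := by
  unfold tiltSum
  refine Finset.measurable_sum _ fun k _ => Finset.measurable_prod _ fun i _ => ?_
  refine ENNReal.measurable_ofReal.comp (Real.measurable_exp.comp ?_)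
  exact (measurable_tilt δ).comp (g := fun p : ℝ × ℝ => tilt δ p.1 p.2)
    (f := fun x : Fin n → ℝ => (x k, x i)) (by fun_prop)

lemma tiltSum_prod_eq {n : ℕ} (δ : ℝ) (x : Fin n → ℝ) (k : Fin n) :
    ∏ i, ENNReal.ofReal (Real.exp (tilt δ (x k) (x i)))
      = ENNReal.ofReal (Real.exp (∑ i, tilt δ (x k) (x i))) := by
  rw [Real.exp_sum, ENNReal.ofReal_prod_of_nonneg fun i _ => (Real.exp_pos _).le]

lemma tiltSum_prod_min {n : ℕ} (δ : ℝ) {x : Fin n → ℝ} {p : Fin n} (hp : ∀ i, x p ≤ x i) :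
    ∏ i, ENNReal.ofReal (Real.exp (tilt δ (x p) (x i))) = 1 := by
  simp [tilt, not_lt.2 (hp _)]

lemma one_le_tiltSum (δ : ℝ) {n : ℕ} (x : Fin (n + 1) → ℝ) : 1 ≤ tiltSum δ x := by
  obtain ⟨p, hp⟩ := Finite.exists_min x
  rw [← tiltSum_prod_min δ hp]
  exact Finset.single_le_sum (f := fun k => ∏ i, ENNReal.ofReal (Real.exp (tilt δ (x k) (x i))))
    (fun _ _ => zero_le) (Finset.mem_univ p)

/-- A point `x k` violating the spread condition has a non-negative sum of tilts, hence a term at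
least `1`. It is not the smallest point, whose term is another `1`. -/
lemma two_le_tiltSum {δ : ℝ} (hδ : 0 < δ) {n : ℕ} {x : Fin n → ℝ} (hx : ∀ i, 0 ≤ x i)
    (h : ¬ SpreadBelow x δ) : 2 ≤ tiltSum δ x := by
  classical
  simp only [SpreadBelow, not_forall, not_le] at h
  obtain ⟨k, ⟨i₀, hi₀⟩, hk⟩ := h
  have : Nonempty (Fin n) := ⟨k⟩
  obtain ⟨p, hp⟩ := Finite.exists_min x
  have hkpos : 0 < x k := (hx i₀).trans_lt hi₀
  have hpk : p ≠ k := fun h => absurd hi₀ (not_lt.2 (h ▸ hp i₀))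
  have hsum : 0 ≤ ∑ i, tilt δ (x k) (x i) := by
    have e : ∀ i, tilt δ (x k) (x i)
        = (if x i < x k then (1 : ℝ) else 0) - max 0 (1 - x i / x k) / δ := by
      intro i
      unfold tilt
      split_ifs with hlt
      · rw [max_eq_right]
        rw [sub_nonneg, div_le_one hkpos]; exact hlt.le
      · rw [max_eq_left]
        · simp
        · rw [sub_nonpos, one_le_div hkpos]; exact not_lt.1 hlt
    simp only [e, Finset.sum_sub_distrib, ← Finset.sum_div]
    rw [sub_nonneg, div_le_iff₀ hδ]
    linarith
  have hprod : 1 ≤ ∏ i, ENNReal.ofReal (Real.exp (tilt δ (x k) (x i))) := by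
    rw [tiltSum_prod_eq, ENNReal.one_le_ofReal]
    exact Real.one_le_exp hsum
  calc (2 : ℝ≥0∞) = 1 + 1 := by norm_num
    _ ≤ ∏ i, ENNReal.ofReal (Real.exp (tilt δ (x p) (x i)))
        + ∏ i, ENNReal.ofReal (Real.exp (tilt δ (x k) (x i))) :=
      add_le_add (tiltSum_prod_min δ hp).ge hprod
    _ = ∑ l ∈ {p, k}, ∏ i, ENNReal.ofReal (Real.exp (tilt δ (x l) (x i))) :=
      (Finset.sum_pair (f := fun l => ∏ i, ENNReal.ofReal (Real.exp (tilt δ (x l) (x i))))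
        hpk).symm
    _ ≤ _ := Finset.sum_le_sum_of_subset (Finset.subset_univ _)

/-- Given `x k = t`, the other `n` points are independent and uniform, so the `k`-th term has
conditional mean at most `(1 - t * (1 - q)) ^ n`. Integrating over `t` gains a factor `1 / (n + 1)`,
which offsets the number of terms. -/
lemma lintegral_tiltSum_le {δ : ℝ} (hδ : 0 < δ) (hq : Real.exp 1 * δ < 1) (n : ℕ) :
    ∫⁻ x, tiltSum δ x ∂(Measure.pi fun _ : Fin (n + 1) => unif)
      ≤ ENNReal.ofReal (1 / (1 - Real.exp 1 * δ)) := by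
  set q := Real.exp 1 * δ with hqdef
  have hq0 : 0 < q := by positivity
  have hmeas : Measurable fun p : ℝ × ℝ => ENNReal.ofReal (Real.exp (tilt δ p.1 p.2)) :=
    ENNReal.measurable_ofReal.comp (Real.measurable_exp.comp (measurable_tilt δ))
  have hterm : ∀ k : Fin (n + 1),
      ∫⁻ x, ∏ i, ENNReal.ofReal (Real.exp (tilt δ (x k) (x i)))
        ∂(Measure.pi fun _ : Fin (n + 1) => unif)
        ≤ ENNReal.ofReal (1 / ((n + 1) * (1 - q))) := by
    intro k
    have hmp := measurePreserving_piFinSuccAbove (fun _ : Fin (n + 1) => unif) k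
    set F : ℝ × (Fin n → ℝ) → ℝ≥0∞ :=
      fun p => ∏ i, ENNReal.ofReal (Real.exp (tilt δ p.1 (p.2 i))) with hF
    have hFm : Measurable F := Finset.measurable_prod _ fun i _ =>
      hmeas.comp (measurable_fst.prodMk ((measurable_pi_apply i).comp measurable_snd))
    have e : ∀ x : Fin (n + 1) → ℝ, ∏ i, ENNReal.ofReal (Real.exp (tilt δ (x k) (x i)))
        = F (MeasurableEquiv.piFinSuccAbove (fun _ => ℝ) k x) := by
      intro x
      rw [Fin.prod_univ_succAbove _ k]
      simp only [tilt, lt_irrefl, if_false, Real.exp_zero, ENNReal.ofReal_one, one_mul]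
      rfl
    simp_rw [e]
    rw [hmp.lintegral_comp hFm, lintegral_prod _ hFm.aemeasurable]
    refine le_trans ?_ (lintegral_one_sub_mul_pow_le (r := 1 - q) (by linarith) (by linarith) n)
    have hpos : ∀ᵐ t ∂unif, t ∈ Ioc (0 : ℝ) 1 := by
      rw [unif, ← restrict_Ioc_eq_restrict_Icc]
      exact ae_restrict_mem measurableSet_Ioc
    refine lintegral_mono_ae (hpos.mono fun t ht => ?_)
    simp only [hF]
    rw [lintegral_pi_prod_eq unif (f := fun x => ENNReal.ofReal (Real.exp (tilt δ t x)))
      (hmeas.comp measurable_prodMk_left)]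
    exact pow_le_pow_left' (lintegral_exp_tilt_le hδ ht.1 ht.2) n
  unfold tiltSum
  rw [lintegral_finsetSum']
  · refine (Finset.sum_le_sum fun k _ => hterm k).trans_eq ?_
    rw [Finset.sum_const, Finset.card_univ, Fintype.card_fin, nsmul_eq_mul,
      ← ENNReal.ofReal_natCast, ← ENNReal.ofReal_mul (by positivity)]
    congr 1
    push_cast
    have : 1 - q ≠ 0 := by linarith
    field_simp
  · intro k _
    refine (Finset.measurable_prod _ fun i _ => ?_).aemeasurable
    exact hmeas.comp (f := fun x : Fin (n + 1) → ℝ => (x k, x i)) (by fun_prop)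

/-- Markov's inequality for `tiltSum - 1`: the sum is never below `1`, so subtracting that
guaranteed unit from the mean `1 / (1 - q)` leaves a bound that vanishes with `δ`. -/
lemma measure_two_le_tiltSum_le {δ : ℝ} (hδ : 0 < δ) (hq : Real.exp 1 * δ < 1) (n : ℕ) :
    (Measure.pi fun _ : Fin (n + 1) => unif) {x | 2 ≤ tiltSum δ x}
      ≤ ENNReal.ofReal (Real.exp 1 * δ / (1 - Real.exp 1 * δ)) := by
  set P := Measure.pi fun _ : Fin (n + 1) => unif
  have hS : MeasurableSet {x : Fin (n + 1) → ℝ | 2 ≤ tiltSum δ x} :=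
    measurableSet_le measurable_const (measurable_tiltSum δ (n + 1))
  have h1 : 1 + P {x | 2 ≤ tiltSum δ x} ≤ ∫⁻ x, tiltSum δ x ∂P := by
    calc 1 + P {x | 2 ≤ tiltSum δ x}
        = ∫⁻ x, 1 + {x : Fin (n + 1) → ℝ | 2 ≤ tiltSum δ x}.indicator 1 x ∂P := by
          rw [lintegral_add_left measurable_const, lintegral_indicator_one hS]
          simp
      _ ≤ _ := by
          refine lintegral_mono fun x => ?_
          by_cases hx : 2 ≤ tiltSum δ x
          · simp only [Set.indicator, mem_ofPred_eq, hx, if_true, Pi.one_apply]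
            exact le_trans (by norm_num) hx
          · simp only [Set.indicator, mem_ofPred_eq, hx, if_false, add_zero]
            exact one_le_tiltSum δ x
  have hq0 : 0 < Real.exp 1 * δ := by positivity
  have h2 := h1.trans (lintegral_tiltSum_le hδ hq n)
  have e : 1 / (1 - Real.exp 1 * δ) = 1 + Real.exp 1 * δ / (1 - Real.exp 1 * δ) := by
    have : 1 - Real.exp 1 * δ ≠ 0 := by linarith
    field_simp
    ring
  rw [e, ENNReal.ofReal_add zero_le_one (div_nonneg hq0.le (by linarith)),
    ENNReal.ofReal_one] at h2
  exact (ENNReal.add_le_add_iff_left ENNReal.one_ne_top).1 h2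

lemma uniformOn_eq_unif : (volume[|Icc (0 : ℝ) 1] : Measure ℝ) = unif := by
  simp [ProbabilityTheory.cond, unif]

lemma map_one_sub_unif : unif.map (fun t => 1 - t) = unif := by
  have h := (Measure.measurePreserving_sub_left (volume : Measure ℝ) 1).restrict_preimage
    (measurableSet_Icc (a := (0 : ℝ)) (b := 1))
  have e : (fun t : ℝ => 1 - t) ⁻¹' Icc 0 1 = Icc 0 1 := by
    ext t
    simp only [mem_preimage, mem_Icc]
    constructor <;> rintro ⟨h1, h2⟩ <;> constructor <;> linarith
  rw [e] at h
  exact h.map_eq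

lemma ae_mem_Icc_of_map_eq_unif {Ω : Type*} [MeasurableSpace Ω] {μ : Measure Ω}
    {X : ℕ → Ω → ℝ} (hX : ∀ i, Measurable (X i))
    (hu : ∀ i, μ.map (X i) = unif) : ∀ᵐ ω ∂μ, ∀ i, X i ω ∈ Icc (0 : ℝ) 1 := by
  refine ae_all_iff.2 fun i => ae_of_ae_map (hX i).aemeasurable ?_
  rw [hu i]
  exact ae_restrict_mem measurableSet_Icc

section Probability

variable {Ω : Type*} [MeasurableSpace Ω] {μ : Measure Ω} [IsProbabilityMeasure μ]

lemma exists_measure_not_spreadBelow_le {X : ℕ → Ω → ℝ} (hX : ∀ i, Measurable (X i))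
    (hind : iIndepFun X μ) (hu : ∀ i, μ.map (X i) = unif) {ε : ℝ≥0∞} (hε : 0 < ε) :
    ∃ δ > 0, ∀ n : ℕ, μ {ω | ¬ SpreadBelow (fun i : Fin n => X i ω) δ} ≤ ε := by
  obtain ⟨e, he0, heε⟩ : ∃ e : ℝ, 0 < e ∧ ENNReal.ofReal e ≤ ε := by
    obtain ⟨e, he0, heε⟩ := ENNReal.lt_iff_exists_real_btwn.1 hε
    exact ⟨e, ENNReal.ofReal_pos.1 heε.1, heε.2.le⟩
  -- Then `q / (1 - q) ≤ 2 * q ≤ e`.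
  set q := min (1 / 2) (e / 2) with hq
  have hq0 : 0 < q := lt_min (by norm_num) (by positivity)
  have hq1 : q ≤ 1 / 2 := min_le_left _ _
  have hqe : q ≤ e / 2 := min_le_right _ _
  have hδ : Real.exp 1 * (q / Real.exp 1) = q := by field_simp
  refine ⟨q / Real.exp 1, by positivity, fun n => ?_⟩
  rcases n with _ | n
  · have : {ω | ¬ SpreadBelow (fun i : Fin 0 => X i ω) (q / Real.exp 1)} = ∅ :=
      Set.eq_empty_of_forall_notMem fun ω hω => hω fun k => k.elim0
    rw [this, measure_empty]
    exact zero_le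
  have hmeas : Measurable fun ω (i : Fin (n + 1)) => X i ω :=
    measurable_pi_lambda _ fun i => hX i
  have hlaw : μ.map (fun ω (i : Fin (n + 1)) => X i ω)
      = Measure.pi fun _ : Fin (n + 1) => unif := by
    rw [(iIndepFun_iff_map_fun_eq_pi_map fun i : Fin (n + 1) => (hX i).aemeasurable).1
      (hind.precomp Fin.val_injective)]
    simp only [hu]
  calc μ {ω | ¬ SpreadBelow (fun i : Fin (n + 1) => X i ω) (q / Real.exp 1)}
      ≤ μ ((fun ω (i : Fin (n + 1)) => X i ω) ⁻¹' {x | 2 ≤ tiltSum (q / Real.exp 1) x}) := by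
        refine measure_mono_ae ((ae_mem_Icc_of_map_eq_unif hX hu).mono fun ω hω h => ?_)
        exact two_le_tiltSum (by positivity) (fun i => (hω i).1) h
    _ ≤ (μ.map fun ω (i : Fin (n + 1)) => X i ω) {x | 2 ≤ tiltSum (q / Real.exp 1) x} :=
        Measure.le_map_apply hmeas.aemeasurable _
    _ ≤ ENNReal.ofReal (q / (1 - q)) := by
        rw [hlaw]
        have := measure_two_le_tiltSum_le (δ := q / Real.exp 1) (by positivity)
          (by rw [hδ]; linarith) n
        rwa [hδ] at this
    _ ≤ ε := by
        refine (ENNReal.ofReal_le_ofReal ?_).trans heε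
        rw [div_le_iff₀ (by linarith)]
        nlinarith

/-! ### Averages of the errors -/

lemma prefixSum_coe (z : ℕ → ℝ) {n j : ℕ} (hj : j ≤ n) :
    prefixSum (fun i : Fin n => z i) j = ∑ i ∈ Finset.range j, z i :=
  Finset.sum_congr rfl fun i hi => by
    rw [dif_pos ((Finset.mem_range.1 hi).trans_le hj)]

lemma measurable_prefixSum (n j : ℕ) : Measurable fun z : Fin n → ℝ => prefixSum z j := by
  unfold prefixSum
  refine Finset.measurable_sum _ fun i _ => ?_
  split_ifs
  · exact measurable_pi_apply _
  · exact measurable_const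

/-- The partial sums for every `n` come from one infinite sequence, so a single `K` serves all `n`.
The events `B N` decrease to a null set, since convergent averages are bounded. -/
lemma exists_measure_prefixSum_le {ξ : ℕ → Ω → ℝ} (hξ : ∀ i, Measurable (ξ i))
    (hind : iIndepFun ξ μ) (hident : ∀ i, IdentDistrib (ξ i) (ξ 0) μ μ)
    (hint : Integrable (ξ 0) μ) {ε : ℝ≥0∞} (hε : 0 < ε) :
    ∃ K : ℝ, ∀ n : ℕ,
      μ {ω | ¬ ∀ j ≤ n, |prefixSum (fun i : Fin n => ξ i ω) j| ≤ K * j} ≤ ε := by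
  set B : ℕ → Set Ω := fun N => {ω | ∃ j : ℕ, (N : ℝ) * j < |∑ i ∈ Finset.range j, ξ i ω|} with hB
  have hBm : ∀ N, MeasurableSet (B N) := fun N => by
    have : B N = ⋃ j : ℕ, {ω | (N : ℝ) * j < |∑ i ∈ Finset.range j, ξ i ω|} := by
      ext ω; simp [hB]
    rw [this]
    exact MeasurableSet.iUnion fun j => measurableSet_lt measurable_const
      (Finset.measurable_sum _ fun i _ => hξ i).abs
  have hBanti : Antitone B := fun N N' hN ω ⟨j, hj⟩ => ⟨j, lt_of_le_of_lt (by gcongr) hj⟩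
  have hlim := tendsto_measure_iInter_atTop (μ := μ) (fun N => (hBm N).nullMeasurableSet) hBanti
    ⟨0, measure_ne_top _ _⟩
  have hzero : μ (⋂ N, B N) = 0 := by
    have hslln := strong_law_ae_real ξ hint (fun i j hij => hind.indepFun hij) hident
    rw [measure_eq_zero_iff_ae_notMem]
    filter_upwards [hslln] with ω hω hmem
    obtain ⟨C, hC⟩ := hω.abs.bddAbove_range
    obtain ⟨N, hN⟩ := exists_nat_ge C
    obtain ⟨j, hj⟩ := mem_iInter.1 hmem N
    have hCj := hC ⟨j, rfl⟩
    rcases Nat.eq_zero_or_pos j with rfl | hpos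
    · simp at hj
    · have hj0 : (0 : ℝ) < j := Nat.cast_pos.2 hpos
      simp only [abs_div, Nat.abs_cast] at hCj
      rw [div_le_iff₀ hj0] at hCj
      have := mul_le_mul_of_nonneg_right hN hj0.le
      linarith
  rw [hzero] at hlim
  obtain ⟨N, hN⟩ := ((ENNReal.tendsto_nhds_zero.1 hlim) ε hε).exists
  refine ⟨N, fun n => (measure_mono fun ω hω => ?_).trans hN⟩
  simp only [mem_ofPred_eq, not_forall, not_le] at hω
  obtain ⟨j, hj, hlt⟩ := hω
  rw [prefixSum_coe (fun i => ξ i ω) hj] at hlt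
  exact ⟨j, hlt⟩

lemma measurableSet_sort_eq {n : ℕ} (σ : Equiv.Perm (Fin n)) :
    MeasurableSet {x : Fin n → ℝ | Tuple.sort x = σ} := by
  have e : {x : Fin n → ℝ | Tuple.sort x = σ} = {x | (∀ i j, i ≤ j → x (σ i) ≤ x (σ j)) ∧
      ∀ i j : Fin n, i < j → x (σ i) = x (σ j) → σ i < σ j} := by
    ext x
    rw [mem_ofPred_eq, eq_comm, Tuple.eq_sort_iff]
    rfl
  rw [e]
  measurability

/-- The event is split according to the permutation sorting the design. It is independent of the
errors, and each fixed permutation preserves their joint law, so every piece inherits the bound for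
the unpermuted partial sums. -/
lemma exists_measure_not_noiseControlled_le {X ξ : ℕ → Ω → ℝ} (hX : ∀ i, Measurable (X i))
    (hξ : ∀ i, Measurable (ξ i)) (hind : iIndepFun ξ μ)
    (hident : ∀ i, IdentDistrib (ξ i) (ξ 0) μ μ) (hint : Integrable (ξ 0) μ)
    (hXξ : IndepFun (fun ω i => X i ω) (fun ω i => ξ i ω) μ) {ε : ℝ≥0∞} (hε : 0 < ε) :
    ∃ K : ℝ, ∀ n : ℕ,
      μ {ω | ¬ NoiseControlled (fun i : Fin n => X i ω) (fun i : Fin n => ξ i ω) K} ≤ ε := by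
  obtain ⟨K, hK⟩ := exists_measure_prefixSum_le hξ hind hident hint hε
  refine ⟨K, fun n => ?_⟩
  set G : Set (Fin n → ℝ) := {z | ¬ ∀ j ≤ n, |prefixSum z j| ≤ K * j} with hG
  have hGm : MeasurableSet G := by
    have e : G = (⋂ j, ⋂ (_ : j ≤ n), {z : Fin n → ℝ | |prefixSum z j| ≤ K * j})ᶜ := by
      ext z; simp [hG]
    rw [e]
    exact (MeasurableSet.iInter fun j => MeasurableSet.iInter fun _ =>
      measurableSet_le (measurable_prefixSum n j).abs measurable_const).compl
  have hXm : Measurable fun ω (i : Fin n) => X i ω := measurable_pi_lambda _ fun i => hX i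
  have hlaw : ∀ σ : Equiv.Perm (Fin n), μ.map (fun ω (i : Fin n) => ξ (σ i) ω)
      = Measure.pi fun _ : Fin n => μ.map (ξ 0) := fun σ => by
    rw [(iIndepFun_iff_map_fun_eq_pi_map fun i : Fin n => (hξ (σ i)).aemeasurable).1
      (hind.precomp (g := fun i : Fin n => ((σ i : Fin n) : ℕ))
        (Fin.val_injective.comp σ.injective))]
    simp only [fun i => (hident i).map_eq]
  have hGσ : ∀ σ : Equiv.Perm (Fin n), μ {ω | (fun i : Fin n => ξ (σ i) ω) ∈ G} ≤ ε := fun σ => by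
    have h1 := Measure.map_apply (μ := μ)
      (measurable_pi_lambda (fun ω (i : Fin n) => ξ (σ i) ω) fun i => hξ (σ i)) hGm
    have h2 := Measure.map_apply (μ := μ)
      (measurable_pi_lambda (fun ω (i : Fin n) => ξ i ω) fun i => hξ i) hGm
    rw [hlaw σ, ← hlaw 1] at h1
    exact (h1.symm.trans h2).trans_le (hK n)
  have hprod : ∀ σ : Equiv.Perm (Fin n),
      μ ({ω | Tuple.sort (fun i : Fin n => X i ω) = σ} ∩ {ω | (fun i : Fin n => ξ (σ i) ω) ∈ G})
        ≤ μ {ω | Tuple.sort (fun i : Fin n => X i ω) = σ} * ε := fun σ => by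
    have h := hXξ.measure_inter_preimage_eq_mul
      ((fun (x : ℕ → ℝ) (i : Fin n) => x i) ⁻¹' {x | Tuple.sort x = σ})
      ((fun (z : ℕ → ℝ) (i : Fin n) => z (σ i)) ⁻¹' G)
      ((measurable_pi_lambda _ fun i => measurable_pi_apply _) (measurableSet_sort_eq σ))
      ((measurable_pi_lambda _ fun i => measurable_pi_apply _) hGm)
    exact h.trans_le (mul_le_mul_right (hGσ σ) _)
  have hsum : ∑ σ : Equiv.Perm (Fin n), μ {ω | Tuple.sort (fun i : Fin n => X i ω) = σ} = 1 := by
    have := sum_measure_preimage_singleton (μ := μ) Finset.univ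
      (f := fun ω => Tuple.sort (fun i : Fin n => X i ω))
      fun σ _ => hXm (measurableSet_sort_eq σ)
    rw [Finset.coe_univ, preimage_univ, measure_univ] at this
    exact this
  calc μ {ω | ¬ NoiseControlled (fun i : Fin n => X i ω) (fun i : Fin n => ξ i ω) K}
      ≤ μ (⋃ σ : Equiv.Perm (Fin n), {ω | Tuple.sort (fun i : Fin n => X i ω) = σ} ∩
          {ω | (fun i : Fin n => ξ (σ i) ω) ∈ G}) := by
        refine measure_mono fun ω hω => mem_iUnion.2
          ⟨Tuple.sort fun i : Fin n => X i ω, rfl, fun hgood => hω ?_⟩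
        exact noiseControlled_of_prefixSum (Tuple.monotone_sort _) hgood
    _ ≤ ∑ σ : Equiv.Perm (Fin n), μ {ω | Tuple.sort (fun i : Fin n => X i ω) = σ} * ε :=
        (measure_iUnion_fintype_le _ _).trans (Finset.sum_le_sum fun σ _ => hprod σ)
    _ = ε := by rw [← Finset.sum_mul, hsum, one_mul]

/-! ### The weak law of large numbers -/

lemma eventually_measure_abs_average_sub_le {Z : ℕ → Ω → ℝ} (hZ : ∀ i, Measurable (Z i))
    (hind : iIndepFun Z μ) (hident : ∀ i, IdentDistrib (Z i) (Z 0) μ μ)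
    (hint : Integrable (Z 0) μ) {η : ℝ} (hη : 0 < η) {ε : ℝ≥0∞} (hε : 0 < ε) :
    ∀ᶠ n : ℕ in atTop,
      μ {ω | η ≤ |(∑ i ∈ Finset.range n, Z i ω) / n - ∫ ω, Z 0 ω ∂μ|} ≤ ε := by
  have hslln := strong_law_ae_real Z hint (fun i j hij => hind.indepFun hij) hident
  have hm := tendstoInMeasure_of_tendsto_ae (fun n =>
    ((Finset.measurable_sum (Finset.range n) fun i _ => hZ i).div_const (n : ℝ)).aestronglyMeasurable)
    hslln
  have := ENNReal.tendsto_nhds_zero.1 (tendstoInMeasure_iff_norm.1 hm η hη) ε hε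
  simpa only [Real.norm_eq_abs] using this

end Probability

/-! ### The empirical norm of the convex estimator -/

/-- If `|f| > D` throughout `I`, the more than `n / 16` design points in `I` alone would push `∑ f²`
above `n * D² / 16 ≥ n * S`. -/
lemma exists_design_point_abs_le {n : ℕ} {x : Fin n → ℝ} {f : ℝ → ℝ} {I : Set ℝ} {S D : ℝ}
    (hn : 1 ≤ n) (hf : ∑ i, f (x i) ^ 2 ≤ n * S) (hS : 16 * S ≤ D ^ 2) (hD : 0 < D)
    (hI : (n : ℝ) / 16 < ∑ i, I.indicator 1 (x i)) : ∃ p ∈ I, |f p| ≤ D := by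
  by_contra hno
  push Not at hno
  have hterm : ∀ i, D ^ 2 * I.indicator 1 (x i) ≤ f (x i) ^ 2 := fun i => by
    by_cases hi : x i ∈ I
    · rw [indicator_of_mem hi, Pi.one_apply, mul_one, ← sq_abs (f (x i))]
      exact pow_le_pow_left₀ hD.le (hno _ hi).le 2
    · rw [indicator_of_notMem hi, mul_zero]
      exact sq_nonneg _
  have h := (Finset.sum_le_sum fun i (_ : i ∈ Finset.univ) => hterm i).trans hf
  rw [← Finset.mul_sum] at h
  have h2 := mul_lt_mul_of_pos_left hI (by positivity : 0 < D ^ 2)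
  have hn' : (0 : ℝ) < n := by exact_mod_cast hn
  nlinarith

lemma sum_add_sq_le {n : ℕ} {b ξ : Fin n → ℝ} {M V : ℝ} (hb : ∀ i, |b i| ≤ M)
    (hξ : ∑ i, ξ i ^ 2 ≤ n * V) : ∑ i, (b i + ξ i) ^ 2 ≤ n * (2 * M ^ 2 + 2 * V) := by
  have hterm : ∀ i, (b i + ξ i) ^ 2 ≤ 2 * M ^ 2 + 2 * ξ i ^ 2 := fun i => by
    have : b i ^ 2 ≤ M ^ 2 := sq_le_sq' (abs_le.1 (hb i)).1 (abs_le.1 (hb i)).2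
    nlinarith [sq_nonneg (b i - ξ i)]
  refine (Finset.sum_le_sum fun i _ => hterm i).trans ?_
  rw [Finset.sum_add_distrib, ← Finset.mul_sum Finset.univ (fun i => ξ i ^ 2),
    Finset.sum_const, Finset.card_univ,
    Fintype.card_fin, nsmul_eq_mul]
  linarith

lemma supNorm01_le {f : ℝ → ℝ} {B : ℝ} (h : ∀ t ∈ Icc (0 : ℝ) 1, |f t| ≤ B) :
    supNorm01 f ≤ (B.toNNReal : ℝ≥0∞) :=
  iSup₂_le fun t ht => by
    rw [Real.enorm_eq_ofReal_abs]
    exact ENNReal.ofReal_le_ofReal (h t ht)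

lemma exists_abs_le_of_supNorm01_lt_top {f : ℝ → ℝ} (h : supNorm01 f < ∞) :
    ∃ M, ∀ t ∈ Icc (0 : ℝ) 1, |f t| ≤ M := by
  refine ⟨(supNorm01 f).toReal, fun t ht => ?_⟩
  have h1 : ‖f t‖ₑ ≤ supNorm01 f := le_iSup₂ (f := fun t (_ : t ∈ Icc (0 : ℝ) 1) => ‖f t‖ₑ) t ht
  have := ENNReal.toReal_mono h.ne h1
  rwa [toReal_enorm, Real.norm_eq_abs] at this

lemma measure_union_le_add {Ω : Type*} [MeasurableSpace Ω] {μ : Measure Ω} {s t : Set Ω} {a b : ℝ≥0∞}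
    (hs : μ s ≤ a) (ht : μ t ≤ b) :
    μ (s ∪ t) ≤ a + b := (measure_union_le s t).trans (add_le_add hs ht)

/-! ### Counting design points, error energy and stochastic boundedness -/

section Probability

variable {Ω : Type*} [MeasurableSpace Ω] {μ : Measure Ω} [IsProbabilityMeasure μ]

lemma eventually_measure_count_le {X : ℕ → Ω → ℝ} (hX : ∀ i, Measurable (X i))
    (hind : iIndepFun X μ) (hu : ∀ i, μ.map (X i) = unif) {a b : ℝ} (ha : 0 ≤ a) (hb : b ≤ 1)
    (hab : b - a = 1 / 8) {ε : ℝ≥0∞} (hε : 0 < ε) :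
    ∀ᶠ n : ℕ in atTop,
      μ {ω | ¬ (n : ℝ) / 16 < ∑ i : Fin n, (Icc a b).indicator 1 (X i ω)} ≤ ε := by
  have hg : Measurable ((Icc a b).indicator (1 : ℝ → ℝ)) :=
    measurable_one.indicator measurableSet_Icc
  have hmean : ∫ ω, (Icc a b).indicator (1 : ℝ → ℝ) (X 0 ω) ∂μ = 1 / 8 := by
    rw [← integral_map (hX 0).aemeasurable hg.aestronglyMeasurable, hu 0,
      integral_indicator_one measurableSet_Icc, unif, measureReal_restrict_apply measurableSet_Icc,
      Icc_inter_Icc, sup_eq_left.2 ha, inf_eq_left.2 hb, Real.volume_real_Icc_of_le (by linarith),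
      hab]
  have hev := eventually_measure_abs_average_sub_le
    (Z := fun i ω => (Icc a b).indicator (1 : ℝ → ℝ) (X i ω)) (μ := μ)
    (fun i => hg.comp (hX i)) (hind.comp _ fun _ => hg)
    (fun i => (⟨(hX i).aemeasurable, (hX 0).aemeasurable, (hu i).trans (hu 0).symm⟩ :
      IdentDistrib (X i) (X 0) μ μ).comp hg)
    (Integrable.of_bound (hg.comp (hX 0)).aestronglyMeasurable 1 (ae_of_all _ fun ω => by
      by_cases h : X 0 ω ∈ Icc a b <;> simp [h])) (η := 1 / 16) (by norm_num) hε
  filter_upwards [hev, eventually_ge_atTop 1] with n hn hn1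
  refine (measure_mono fun ω hω => ?_).trans hn
  simp only [mem_ofPred_eq, not_lt] at hω ⊢
  have hn' : (0 : ℝ) < n := by exact_mod_cast hn1
  rw [hmean, Finset.sum_range]
  -- The mean frequency is `1/8`, so a frequency of at most `1/16` is a deviation of at least
  -- `1/16`.
  have h1 : (∑ i : Fin n, (Icc a b).indicator 1 (X i ω)) / n ≤ (1 / 16 : ℝ) := by
    rw [div_le_iff₀ hn']
    linarith
  rw [abs_sub_comm]
  exact le_trans (by linarith) (le_abs_self _)

lemma exists_eventually_measure_sum_sq_le {ξ : ℕ → Ω → ℝ} (hξ : ∀ i, Measurable (ξ i))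
    (hind : iIndepFun ξ μ) (hident : ∀ i, IdentDistrib (ξ i) (ξ 0) μ μ)
    (hL2 : MemLp (ξ 0) 2 μ) :
    ∃ V : ℝ, 0 ≤ V ∧ ∀ ε : ℝ≥0∞, 0 < ε → ∀ᶠ n : ℕ in atTop,
      μ {ω | ¬ ∑ i : Fin n, ξ i ω ^ 2 ≤ n * V} ≤ ε := by
  have hg : Measurable fun t : ℝ => t ^ 2 := by fun_prop
  refine ⟨∫ ω, ξ 0 ω ^ 2 ∂μ + 1, add_nonneg (integral_nonneg fun ω => sq_nonneg _) zero_le_one,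
    fun ε hε => ?_⟩
  have hev := eventually_measure_abs_average_sub_le (Z := fun i ω => ξ i ω ^ 2) (μ := μ)
    (fun i => hg.comp (hξ i)) (hind.comp _ fun _ => hg) (fun i => (hident i).comp hg)
    hL2.integrable_sq (η := 1) one_pos hε
  filter_upwards [hev, eventually_ge_atTop 1] with n hn hn1
  refine (measure_mono fun ω hω => ?_).trans hn
  simp only [mem_ofPred_eq, not_le] at hω ⊢
  have hn' : (0 : ℝ) < n := by exact_mod_cast hn1
  rw [Finset.sum_range]
  refine le_trans ?_ (le_abs_self _)
  rw [le_sub_iff_add_le, le_div_iff₀ hn']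
  linarith

lemma stochasticallyBounded_isotonic {X ξ : ℕ → Ω → ℝ} {f₀ : ℝ → ℝ} {M : ℝ}
    (hX : ∀ i, Measurable (X i)) (hu : ∀ i, μ.map (X i) = unif)
    (hξ : ∀ i, Measurable (ξ i)) (hξind : iIndepFun ξ μ)
    (hident : ∀ i, IdentDistrib (ξ i) (ξ 0) μ μ) (hint : Integrable (ξ 0) μ)
    (hXξ : IndepFun (fun ω i => X i ω) (fun ω i => ξ i ω) μ)
    (hM : ∀ t ∈ Icc (0 : ℝ) 1, |f₀ t| ≤ M) {fhat : ℕ → Ω → ℝ → ℝ}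
    (hfhat : ∀ n, 1 ≤ n → ∀ᵐ ω ∂μ, IsCanonicalIsotonicLSE (n := n)
      (fun i => X i ω) (fun i => f₀ (X i ω) + ξ i ω) (fhat n ω)) :
    StochasticallyBounded μ (fun n ω => supNorm01 (fhat n ω)) := by
  intro ε hε
  have hε2 : 0 < ε / 2 := ENNReal.half_pos hε.ne'
  have hXξ' : IndepFun (fun ω i => 1 - X i ω) (fun ω i => ξ i ω) μ :=
    hXξ.comp (φ := fun (x : ℕ → ℝ) i => 1 - x i) (ψ := id) (by fun_prop) measurable_id
  obtain ⟨K₁, hK₁⟩ := exists_measure_not_noiseControlled_le hX hξ hξind hident hint hXξ hε2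
  obtain ⟨K₂, hK₂⟩ := exists_measure_not_noiseControlled_le
    (X := fun i ω => 1 - X i ω) (fun i => (hX i).const_sub 1) hξ hξind hident hint hXξ' hε2
  refine ⟨(M + max K₁ K₂).toNNReal, ?_⟩
  filter_upwards [eventually_ge_atTop 1] with n hn
  refine le_trans (measure_mono_ae ?_)
    ((measure_union_le_add (hK₁ n) (hK₂ n)).trans_eq (ENNReal.add_halves ε))
  filter_upwards [hfhat n hn, ae_mem_Icc_of_map_eq_unif hX hu] with ω hω hx hbad
  by_contra hgood
  obtain ⟨h1, h2⟩ := not_or.1 hgood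
  have h1 := (not_not.1 h1).mono (le_max_left K₁ K₂)
  have h2 := (not_not.1 h2).mono (le_max_right K₁ K₂)
  refine not_le.2 hbad (supNorm01_le fun t ht => ?_)
  exact hω.abs_le hn (fun i => hx i)
    (hω.isLSE.isotonic_abs_le (fun i => hx i) (fun i => hM _ (hx i)) h1 h2) ht

lemma stochasticallyBounded_convex {X ξ : ℕ → Ω → ℝ} {f₀ : ℝ → ℝ} {M : ℝ}
    (hX : ∀ i, Measurable (X i)) (hXind : iIndepFun X μ) (hu : ∀ i, μ.map (X i) = unif)
    (hξ : ∀ i, Measurable (ξ i)) (hξind : iIndepFun ξ μ)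
    (hident : ∀ i, IdentDistrib (ξ i) (ξ 0) μ μ) (hL2 : MemLp (ξ 0) 2 μ)
    (hXξ : IndepFun (fun ω i => X i ω) (fun ω i => ξ i ω) μ)
    (hM : ∀ t ∈ Icc (0 : ℝ) 1, |f₀ t| ≤ M) {fhat : ℕ → Ω → ℝ → ℝ}
    (hfhat : ∀ n, 1 ≤ n → ∀ᵐ ω ∂μ, IsCanonicalConvexLSE (n := n)
      (fun i => X i ω) (fun i => f₀ (X i ω) + ξ i ω) (fhat n ω)) :
    StochasticallyBounded μ (fun n ω => supNorm01 (fhat n ω)) := by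
  intro ε hε
  -- There are nine exceptional events: noise control and spread, each from both ends, the error
  -- energy, and the four interval counts.
  have hε9 : 0 < ε / 9 := ENNReal.div_pos hε.ne' (by norm_num)
  have hint := hL2.integrable one_le_two
  have hX' : ∀ i, Measurable fun ω => 1 - X i ω := fun i => (hX i).const_sub 1
  have hXind' : iIndepFun (fun i ω => 1 - X i ω) μ :=
    hXind.comp (fun _ t => 1 - t) fun _ => by fun_prop
  have hu' : ∀ i, μ.map (fun ω => 1 - X i ω) = unif := fun i => by
    have := Measure.map_map (μ := μ) (g := fun t : ℝ => 1 - t) (by fun_prop) (hX i)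
    rw [hu i, map_one_sub_unif] at this
    exact this.symm
  have hXξ' : IndepFun (fun ω i => 1 - X i ω) (fun ω i => ξ i ω) μ :=
    hXξ.comp (φ := fun (x : ℕ → ℝ) i => 1 - x i) (ψ := id) (by fun_prop) measurable_id
  obtain ⟨K₁, hK₁⟩ := exists_measure_not_noiseControlled_le hX hξ hξind hident hint hXξ hε9
  obtain ⟨K₂, hK₂⟩ := exists_measure_not_noiseControlled_le
    (X := fun i ω => 1 - X i ω) hX' hξ hξind hident hint hXξ' hε9
  obtain ⟨δ₁, hδ₁, hS₁⟩ := exists_measure_not_spreadBelow_le hX hXind hu hε9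
  obtain ⟨δ₂, hδ₂, hS₂⟩ := exists_measure_not_spreadBelow_le
    (X := fun i ω => 1 - X i ω) hX' hXind' hu' hε9
  obtain ⟨V, hV0, hV⟩ := exists_eventually_measure_sum_sq_le hξ hξind hident hL2
  set S := 2 * M ^ 2 + 2 * V with hS
  -- The summand `1` keeps `D` positive even when `S = 0`.
  set D := 4 * Real.sqrt S + 1 with hD
  have hDpos : 0 < D := by positivity
  have hSD : 16 * S ≤ D ^ 2 := by
    have := Real.sq_sqrt (by positivity : 0 ≤ S)
    have := Real.sqrt_nonneg S
    nlinarith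
  refine ⟨(max (17 * D) ((M + max K₁ K₂ + 17 * D) / min δ₁ δ₂)).toNNReal, ?_⟩
  filter_upwards [eventually_ge_atTop 1, hV _ hε9,
    eventually_measure_count_le hX hXind hu (a := 1 / 8) (b := 1 / 4)
      (by norm_num) (by norm_num) (by norm_num) hε9,
    eventually_measure_count_le hX hXind hu (a := 3 / 8) (b := 1 / 2)
      (by norm_num) (by norm_num) (by norm_num) hε9,
    eventually_measure_count_le hX hXind hu (a := 1 / 2) (b := 5 / 8)
      (by norm_num) (by norm_num) (by norm_num) hε9,
    eventually_measure_count_le hX hXind hu (a := 3 / 4) (b := 7 / 8)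
      (by norm_num) (by norm_num) (by norm_num) hε9] with n hn hVn hc₁ hc₂ hc₃ hc₄
  have hunion := measure_union_le_add (hK₁ n) <| measure_union_le_add (hK₂ n) <|
    measure_union_le_add (hS₁ n) <| measure_union_le_add (hS₂ n) <| measure_union_le_add hVn <|
    measure_union_le_add hc₁ <| measure_union_le_add hc₂ <| measure_union_le_add hc₃ hc₄
  have htotal : ε / 9 + (ε / 9 + (ε / 9 + (ε / 9 + (ε / 9 + (ε / 9 + (ε / 9 + (ε / 9 + ε / 9)))))))
      ≤ ε := by
    refine le_trans (le_of_eq ?_) (ENNReal.mul_div_le (a := 9) (b := ε))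
    ring
  refine le_trans (measure_mono_ae ?_) (hunion.trans htotal)
  filter_upwards [hfhat n hn, ae_mem_Icc_of_map_eq_unif hX hu] with ω hω hx hbad
  by_contra hgood
  obtain ⟨h1, hgood⟩ := not_or.1 hgood
  obtain ⟨h2, hgood⟩ := not_or.1 hgood
  obtain ⟨h3, hgood⟩ := not_or.1 hgood
  obtain ⟨h4, hgood⟩ := not_or.1 hgood
  obtain ⟨h5, hgood⟩ := not_or.1 hgood
  obtain ⟨h6, hgood⟩ := not_or.1 hgood
  obtain ⟨h7, hgood⟩ := not_or.1 hgood
  obtain ⟨h8, h9⟩ := not_or.1 hgood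
  have hb : ∀ i : Fin n, |f₀ (X i ω)| ≤ M := fun i => hM _ (hx i)
  have hsq := (hω.isLSE.sum_sq_le convex_convexModel (convexOn_const 0 (convex_Icc 0 1))).trans
    (sum_add_sq_le hb (not_not.1 h5))
  refine not_le.2 hbad (supNorm01_le fun t ht => ?_)
  exact hω.abs_le hn (fun i => hx i) hb ((not_not.1 h1).mono (le_max_left _ _))
    ((not_not.1 h2).mono (le_max_right _ _)) (lt_min hδ₁ hδ₂)
    ((not_not.1 h3).mono (min_le_left _ _)) ((not_not.1 h4).mono (min_le_right _ _))
    ⟨exists_design_point_abs_le hn hsq hSD hDpos (not_not.1 h6),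
      exists_design_point_abs_le hn hsq hSD hDpos (not_not.1 h7),
      exists_design_point_abs_le hn hsq hSD hDpos (not_not.1 h8),
      exists_design_point_abs_le hn hsq hSD hDpos (not_not.1 h9)⟩ ht

end Probability

theorem mainTheorem6 {Ω : Type*} [MeasurableSpace Ω] (μ : Measure Ω) [IsProbabilityMeasure μ]
    (X ξ : ℕ → Ω → ℝ) (f₀ : ℝ → ℝ)
    -- the covariates are i.i.d. uniform on `[0,1]`
    (hX_meas : ∀ i, Measurable (X i))
    (hX_indep : iIndepFun X μ)
    (hX_unif : ∀ i, pdf.IsUniform (X i) (Icc (0 : ℝ) 1) μ volume)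
    -- the errors are i.i.d., centred, with a finite second moment
    (hξ_meas : ∀ i, Measurable (ξ i))
    (hξ_indep : iIndepFun ξ μ)
    (hξ_ident : ∀ i, IdentDistrib (ξ i) (ξ 0) μ μ)
    (hξ_L2 : MemLp (ξ 0) 2 μ)
    (hξ_mean : ∫ ω, ξ 0 ω ∂μ = 0)
    -- the errors are independent of the covariates
    (hXξ : IndepFun (fun ω i => X i ω) (fun ω i => ξ i ω) μ)
    -- the regression function is measurable and bounded on `[0,1]`
    (hf₀_meas : Measurable ((Icc (0 : ℝ) 1).domRestrict f₀))
    (hf₀_bdd : supNorm01 f₀ < ∞) :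
    (∀ fhat : ℕ → Ω → ℝ → ℝ,
      (∀ n, 1 ≤ n → ∀ᵐ ω ∂μ, IsCanonicalIsotonicLSE (n := n)
        (fun i => X i ω) (fun i => f₀ (X i ω) + ξ i ω) (fhat n ω)) →
      StochasticallyBounded μ (fun n ω => supNorm01 (fhat n ω))) ∧
    (∀ fhat : ℕ → Ω → ℝ → ℝ,
      (∀ n, 1 ≤ n → ∀ᵐ ω ∂μ, IsCanonicalConvexLSE (n := n)
        (fun i => X i ω) (fun i => f₀ (X i ω) + ξ i ω) (fhat n ω)) →
      StochasticallyBounded μ (fun n ω => supNorm01 (fhat n ω))) := by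
  have hu : ∀ i, μ.map (X i) = unif := fun i => (hX_unif i).trans uniformOn_eq_unif
  obtain ⟨M, hM⟩ := exists_abs_le_of_supNorm01_lt_top hf₀_bdd
  exact ⟨fun _ hfhat => stochasticallyBounded_isotonic hX_meas hu hξ_meas hξ_indep hξ_ident
      (hξ_L2.integrable one_le_two) hXξ hM hfhat,
    fun _ hfhat => stochasticallyBounded_convex hX_meas hX_indep hu hξ_meas hξ_indep hξ_ident
      hξ_L2 hXξ hM hfhat⟩
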